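/- Let $l\ge 3$ be a prime and let $\mathbb F_q$ be a finite field with $q\equiv 1\pmod{2l^2}$. Let $\gamma$ be a generator of $\mathbb F_q^*$; for $v\ne 0$ let $\mathrm{ind}_\gamma v$ be the least $k\ge 0$ with $\gamma^k=v$, and put $w=\mathrm{ind}_\gamma 2$. For $e\mid q-1$ let $\zeta_e=\exp(2\pi i/e)$, let $\chi_e$ be the multiplicative character of $\mathbb F_q$ with $\chi_e(\gamma)=\zeta_e$ (all powers $\chi_e^i$, also $i=0$, take the value $0$ at $0$), and $$J_e(i,j)=\sum_{v\in\mathbb F_q}\chi_e^i(v)\,\chi_e^j(v+1)\qquad(i,j\in\mathbb Z).$$ For $n\in\mathbb Z$ write $J_l(1,n)=\sum_{m=0}^{l-1}b_{m}(n)\zeta_l^m$, where $b_m(n)$ is the number of $v\neq 0,-1$ in $\mathbb F_q$ with $\mathrm{ind}_\gamma v+n\,\mathrm{ind}_\gamma(v+1)\equiv m\pmod l$. Let $(h,k)_{l^2}$ be the cyclotomic number of order $l^2$, i.e. the number of $v\ne0,-1$ with $\mathrm{ind}_\gamma v\equiv h$ and $\mathrm{ind}_\gamma(v+1)\equiv k\pmod{l^2}$.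 Put $$c_{i,n}=\sum_{m=0}^{l-1}\binom mi b_m(n)\quad(3\le i\le l-1),\qquad c_{l,n}=S(n)=\sum_{h,k=0}^{l^2-1}(h,k)_{l^2}\Big\lfloor\frac{h+nk}{l}\Big\rfloor .$$ All congruences below are in the ring $\mathbb Z[\zeta_{2l^2}]=\mathbb Z[\zeta_{l^2}]$ modulo $(1-\zeta_{l^2})^{l+1}$. Then: (0) For $1\le n\le l^2-1$: $J_{l^2}(1,n)\equiv -1+\sum_{i=3}^{l}c_{i,n}(\zeta_{l^2}-1)^i$ if $\gcd(l,n)=1$, and $J_{l^2}(1,n)\equiv-1$ if $\gcd(l,n)=l$. (1) $J_{2l^2}(1,l^2)\equiv \zeta_{l^2}^{-w}\Big(-1+\sum_{i=3}^{l}c_{i,(l^2-1)/2}(\zeta_{l^2}-1)^i\Big)$. (2) For every odd $d\ne l$ with $1\le d\le 2l-1$: $$J_{2l^2}(1,dl)\equiv-\zeta_{l^2}^{-w(dl+1)}\Big(-1+\sum_{i=3}^{l}c_{i,(l^2-1)/2}(\zeta_{l^2}-1)^i\Big)\Big(-1+\sum_{i=3}^{l}c_{i,dl-1}(\zeta_{l^2}^{(-1-dl)/2}-1)^i\Big).$$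 (3) For $1\le n<2l^2-1$ with $\gcd(n,2l^2)=1$: $$J_{2l^2}(1,n)\equiv\zeta_{l^2}^{-w(n+1)}\Big(-1+\sum_{i=3}^{l}c_{i,(l^2-1)/2}(\zeta_{l^2}-1)^i\Big)\Big(-1+\sum_{i=3}^{l}c_{i,(l^2-1)/2}(\zeta_{l^2}^{n}-1)^i\Big)\Big(-1+\sum_{i=3}^{l}c_{i,-1-n}(\zeta_{l^2}^{(1-l^2)/2}-1)^i\Big).$$ (4) $J_{2l^2}(1,2l^2-1)\equiv-1$. Every odd $n$ with $1\le n\le 2l^2-1$ satisfies $n=l^2$, or $n=dl$ with $d$ as in (2), or the conditions in (3), or $n=2l^2-1$. (5) For every even $n$ with $2\le n\le 2l^2-2$: $J_{2l^2}(1,n)=\chi_{2l^2}(-1)J_{2l^2}(1,2l^2-n-1)$. For every even $d$ with $1\le d\le 2l-1$: $J_{2l^2}(1,dl)=\chi_{2l^2}(-1)J_{2l^2}(1,2l^2-dl-1)$, and $2l^2-dl-1$ is odd. (6) All Jacobi sums of order $2l^2$ are thereby determined modulo $(1-\zeta_{l^2})^{l+1}$: every $J_{2l^2}(1,n)$, $n\in\mathbb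 Z$, is a unit modulo $(1-\zeta_{l^2})^{l+1}$, and for all integers $i\ge 0$, $j\ge 1$, $$J_{2l^2}(i,j)\prod_{t=1}^{j-1}J_{2l^2}(1,t)\equiv\chi_{2l^2}(-1)^{i+1}\prod_{t=i}^{i+j-1}J_{2l^2}(1,t).$$ -/

import Mathlib

namespace JacobiCong

/-- The root of unity `ζ_e = exp (2πi / e)`. -/
noncomputable def zeta (e : ℕ) : ℂ := Complex.exp (2 * Real.pi * Complex.I / e)

section
variable {F : Type*} [Field F] [Fintype F]

/-- The index (discrete logarithm) `ind_γ v` of a nonzero `v`: the least `k ≥ 0` with `γ ^ k = v`. -/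
noncomputable def ind (γ : Fˣ) (v : F) : ℕ := sInf {k : ℕ | (γ : F) ^ k = v}

open Classical in
/-- The power `χ_e ^ i` of the multiplicative character `χ_e` with `χ_e γ = ζ_e`,
extended to `F` by the value `0` at `0` (also for `i = 0`). -/
noncomputable def chi (γ : Fˣ) (e : ℕ) (i : ℤ) (v : F) : ℂ :=
  if v = 0 then 0 else zeta e ^ (i * (ind γ v : ℤ))

/-- The Jacobi sum `J_e(i,j) = ∑_v χ_e^i(v) χ_e^j(v+1)`. -/
noncomputable def J (γ : Fˣ) (e : ℕ) (i j : ℤ) : ℂ :=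
  ∑ v : F, chi γ e i v * chi γ e j (v + 1)

open Classical in
/-- The coefficient `b_m` of `ζ_e ^ m` in `J_e(1,n) = ∑_{m=0}^{e-1} b_m ζ_e ^ m`: the number
of `v ≠ 0, -1` with `ind v + n ind (v+1) ≡ m` modulo `e`. -/
noncomputable def jacobiCoeff (γ : Fˣ) (e : ℕ) (n : ℤ) (m : ℕ) : ℕ :=
  (Finset.univ.filter fun v : F => v ≠ 0 ∧ v + 1 ≠ 0 ∧
    (ind γ v : ℤ) + n * (ind γ (v + 1) : ℤ) ≡ (m : ℤ) [ZMOD (e : ℤ)]).card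

open Classical in
/-- The cyclotomic number `(h,k)_e`. -/
noncomputable def cyclotomicNumber (γ : Fˣ) (e h k : ℕ) : ℕ :=
  (Finset.univ.filter fun v : F => v ≠ 0 ∧ v + 1 ≠ 0 ∧
    ind γ v ≡ h [MOD e] ∧ ind γ (v + 1) ≡ k [MOD e]).card

/-- `S(n) = ∑_{h,k} (h,k)_{l²} ⌊(h + nk)/l⌋`, where `h, k` run over `0, …, l² - 1`. -/
noncomputable def S (γ : Fˣ) (l : ℕ) (n : ℤ) : ℤ :=
  ∑ h ∈ Finset.range (l ^ 2), ∑ k ∈ Finset.range (l ^ 2),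
    (cyclotomicNumber γ (l ^ 2) h k : ℤ) * (((h : ℤ) + n * (k : ℤ)) / (l : ℤ))

/-- The coefficients `c_{i,n}`: for `i < l` they come from the coefficients of the Jacobi sum
`J_l(1,n)` of order `l`, and `c_{l,n} = S(n)`. -/
noncomputable def c (γ : Fˣ) (l : ℕ) (i : ℕ) (n : ℤ) : ℤ :=
  if i = l then S γ l n
  else ∑ m ∈ Finset.range l, (m.choose i : ℤ) * (jacobiCoeff γ l n m : ℤ)

/-- The expression `-1 + ∑_{i=3}^{l} c_{i,n} (x - 1)^i`. -/
noncomputable def cExpr (γ : Fˣ) (l : ℕ) (n : ℤ) (x : ℂ) : ℂ :=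
  -1 + ∑ i ∈ Finset.Icc 3 l, (c γ l i n : ℂ) * (x - 1) ^ i

end

/-- The ring `ℤ[ζ_{2l²}] = ℤ[ζ_{l²}]` (for odd `l`), as a subring of `ℂ`. -/
noncomputable def ringZ (l : ℕ) : Subalgebra ℤ ℂ := Algebra.adjoin ℤ {zeta (2 * l ^ 2)}

/-- Congruence of `x` and `y` modulo `(1 - ζ_{l²})^{l+1}` in `ℤ[ζ_{2l²}]`. -/
def Cong (l : ℕ) (x y : ℂ) : Prop :=
  ∃ z ∈ ringZ l, x - y = (1 - zeta (l ^ 2)) ^ (l + 1) * z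

end JacobiCong

/-!
All congruences are equalities in the residue ring `A` of `ℤ[ζ_{2l²}]` modulo
`(1 - ζ_{l²}) ^ (l + 1)`, and they are proved there. In `A` the prime `l` vanishes, because
`(1 - ζ_{l²}) ^ (l (l - 1))` divides `l` and `l + 1 ≤ l (l - 1)`
(`exists_natCast_eq_mul`). Hence `q = 1` in `A`, and the sum over `F` of any power of the character
`X` with `X γ = ζ_{2l²}`, the trivial one included, is `0` in `A`. With this, the relations between
Jacobi sums hold in `A` for all powers of `X`, with no exceptions for trivial characters, and Gauss
sums are not needed:

* the cocycle relation `K(a,b) K(ab,c) = K(b,c) K(a,bc)`, both sides being the sum of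
  `a(x) b(y) c(z)` over `x + y + z = 1` (`jacobiSum_cocycle`);
* the symmetry of `K(a,b)` in `a`, `b`, `(ab)⁻¹` up to sign (`jacobiSum_eq_mul_jacobiSum_inv`);
* the duplication formula `K(a,a) = a⁻¹(4) K(a,ρ)`, with `ρ` the quadratic character
  (`jacobiSum_self`).

Together they express `K(ρη,ρψ)` by Jacobi sums of `η` and `ψ` (`jacobiSum_quadChar_mul`). As
`X = ρ X ^ (1 - l²)`, this reduces `J_{2l²}(1,n)` with odd `n` to Jacobi sums of order `l²`
(`JacobiSetting.jac_odd`), and the symmetry reduces even `n` to odd `n`.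

For the Jacobi sums of order `l²`, let `z` be a power of `ζ_{l²}` and `t = z - 1`. Since
`t ^ (l + 1) = 0` and `z ^ l = 1 + t ^ l` in `A`, an integer power `z ^ a` equals
`∑_{i < l} (a mod l choose i) t ^ i + ⌊a / l⌋ t ^ l` (`val_zpow_eq_sum`). Summed over `v` with
`a = ind v + n ind (v + 1)`, the coefficients for `i ≥ 3` are the `c_{i,n}`, the constant term is
`q - 2 = -1`, and the coefficients of `t` and `t ^ 2` vanish since the sums over `v` of `ind v`, of
`(ind v) ^ 2` and of `ind v * ind (v + 1)` are `0` modulo `l` (`sum_zpow_expo`).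

The product formula for `J_{2l²}(i,j)` follows from the cocycle relation by induction on `j`, and
`J_{2l²}(1,n)` is a unit in `A` because each factor `-1 + ∑ c_i t ^ i` is the sum of a unit and a
nilpotent element.
-/

namespace JacobiCong

/-! ### Jacobi sums over rings with zero divisors -/

section JacobiSums
variable {F : Type*} [Field F] [Fintype F] {A : Type*} [CommRing A]

/-- The convolution of `a` and `b` is the multiple `jacobiSum a b` of `a * b`. The vanishing of
`∑ v, (a * b) v` is what is needed at `s = 0`. -/
lemma sum_mulChar_mul_sub {a b : MulChar F A} (h : ∑ v, (a * b) v = 0) (s : F) :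
    ∑ x, a x * b (s - x) = (a * b) s * jacobiSum a b := by
  rcases eq_or_ne s 0 with rfl | hs
  · have h1 : ∀ x : F, a x * b (0 - x) = b (-1) * (a * b) x := fun x => by
      rw [zero_sub, ← neg_one_mul x, map_mul, MulChar.mul_apply]; ring
    rw [Finset.sum_congr rfl fun x _ => h1 x, ← Finset.mul_sum, h, mul_zero,
      MulChar.map_nonunit _ not_isUnit_zero, zero_mul]
  · rw [jacobiSum, Finset.mul_sum, ← Equiv.sum_comp (Equiv.mulLeft₀ s hs)]
    refine Finset.sum_congr rfl fun x _ => ?_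
    rw [Equiv.mulLeft₀_apply, show s - s * x = s * (1 - x) by ring, map_mul, map_mul,
      MulChar.mul_apply]
    ring

/-- A product of two Jacobi sums as a sum over `x + y + z = 1`. -/
lemma jacobiSum_mul_jacobiSum_eq_sum {a b : MulChar F A} (h : ∑ v, (a * b) v = 0)
    (c : MulChar F A) :
    jacobiSum a b * jacobiSum (a * b) c = ∑ x, ∑ y, a x * b y * c (1 - x - y) := by
  have h1 : ∀ x : F, ∑ y, a x * b y * c (1 - x - y) = ∑ s, a x * b (s - x) * c (1 - s) := by
    intro x
    rw [← Equiv.sum_comp (Equiv.subRight x)]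
    refine Finset.sum_congr rfl fun s _ => ?_
    rw [Equiv.subRight_apply, show 1 - x - (s - x) = 1 - s by ring]
  simp_rw [h1]
  rw [Finset.sum_comm, jacobiSum.eq_1 (a * b) c, Finset.mul_sum]
  refine Finset.sum_congr rfl fun s _ => ?_
  rw [← Finset.sum_mul, sum_mulChar_mul_sub h]
  ring

/-- The cocycle relation for Jacobi sums. -/
lemma jacobiSum_cocycle {a b c : MulChar F A} (hab : ∑ v, (a * b) v = 0)
    (hbc : ∑ v, (b * c) v = 0) :
    jacobiSum a b * jacobiSum (a * b) c = jacobiSum b c * jacobiSum a (b * c) := by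
  rw [jacobiSum_comm a (b * c), jacobiSum_mul_jacobiSum_eq_sum hab,
    jacobiSum_mul_jacobiSum_eq_sum hbc, Finset.sum_comm]
  refine Finset.sum_congr rfl fun y _ => ?_
  rw [← Equiv.sum_comp (Equiv.subLeft (1 - y))]
  refine Finset.sum_congr rfl fun x _ => ?_
  rw [Equiv.subLeft_apply, show 1 - (1 - y - x) - y = x by ring]
  ring

/-- The substitution `x ↦ x / (x - 1)` exchanges `b` with `(a * b)⁻¹`. -/
lemma jacobiSum_eq_mul_jacobiSum_inv (a b : MulChar F A) :
    jacobiSum a b = a (-1) * jacobiSum a (a * b)⁻¹ := by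
  classical
  have key : ∀ a' b' : MulChar F A,
      jacobiSum a' b' = ∑ x ∈ Finset.univ.erase 1, a' x * b' (1 - x) := fun a' b' =>
    (Finset.sum_erase _ (by simp [MulChar.map_nonunit])).symm
  rw [key, key, Finset.mul_sum]
  refine Finset.sum_nbij' (fun x => x / (x - 1)) (fun x => x / (x - 1)) ?_ ?_ ?_ ?_ ?_
  · intro x hx
    have hx : x - 1 ≠ 0 := sub_ne_zero.2 (Finset.ne_of_mem_erase hx)
    simp [div_eq_iff hx, eq_comm (a := x)]
  · intro x hx
    have hx : x - 1 ≠ 0 := sub_ne_zero.2 (Finset.ne_of_mem_erase hx)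
    simp [div_eq_iff hx, eq_comm (a := x)]
  · intro x hx
    have hx : x - 1 ≠ 0 := sub_ne_zero.2 (Finset.ne_of_mem_erase hx)
    field_simp
    simp
  · intro x hx
    have hx : x - 1 ≠ 0 := sub_ne_zero.2 (Finset.ne_of_mem_erase hx)
    field_simp
    simp
  · intro x hx
    have hx : x - 1 ≠ 0 := sub_ne_zero.2 (Finset.ne_of_mem_erase hx)
    have h1 : 1 - x ≠ 0 := by rwa [← neg_sub, neg_ne_zero]
    have h2 : a x = a (-1) * a (x / (x - 1)) * a (1 - x) := by
      rw [← map_mul, ← map_mul]; congr 1; field_simp; ring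
    have h3 : (1 - x / (x - 1))⁻¹ = 1 - x := by field_simp; ring
    rw [MulChar.inv_apply', h3, MulChar.mul_apply, h2]
    ring

lemma jacobiSum_one_left {b : MulChar F A} (h : ∑ v, b v = 0) : jacobiSum 1 b = -1 := by
  classical
  have h0 : b (1 - 0) = 1 := by simp
  rw [jacobiSum, ← Finset.sum_erase (a := 0) _ (by simp [MulChar.map_nonunit])]
  rw [Finset.sum_congr rfl (g := fun x => b (1 - x)) fun x hx => by
    rw [MulChar.one_apply (isUnit_iff_ne_zero.2 (Finset.ne_of_mem_erase hx)), one_mul]]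
  rw [Finset.sum_erase_eq_sub (Finset.mem_univ _), h0]
  have h2 : ∑ x, b (1 - x) = ∑ x, b x := Equiv.sum_comp (Equiv.subLeft (1 : F)) b
  rw [h2, h, zero_sub]

lemma jacobiSum_inv_right {a : MulChar F A} (h : ∑ v, a v = 0) :
    jacobiSum a a⁻¹ = -a (-1) := by
  rw [jacobiSum_eq_mul_jacobiSum_inv, mul_inv_cancel, inv_one, jacobiSum_comm,
    jacobiSum_one_left h, mul_neg_one]

/-- The quadratic character of `F` with values in `A`. -/
noncomputable def quadChar (F : Type*) [Field F] [Fintype F] (A : Type*) [CommRing A] :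
    MulChar F A :=
  open Classical in (quadraticChar F).ringHomComp (Int.castRingHom A)

lemma quadChar_mul_self : quadChar F A * quadChar F A = 1 := by
  classical
  have := ((quadraticChar_isQuadratic F).comp (Int.castRingHom A)).sq_eq_one
  rw [pow_two] at this
  rw [quadChar]
  convert this

/-- The duplication formula: `x (1 - x) = s` has `1 + ρ (1 - 4 s)` solutions, `ρ` being the
quadratic character. -/
lemma jacobiSum_self {a : MulChar F A} (h : ∑ v, a v = 0) (hF : (2 : F) ≠ 0) :
    jacobiSum a a = a⁻¹ 4 * jacobiSum a (quadChar F A) := by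
  classical
  have h4 : (4 : F) ≠ 0 := by
    rw [show (4 : F) = 2 * 2 by norm_num]; exact mul_ne_zero hF hF
  have hch : ringChar F ≠ 2 := fun hc => hF <| by
    have := ringChar.Nat.cast_ringChar (R := F)
    rw [hc] at this; exact_mod_cast this
  have hcount : ∀ s : F, ((Finset.univ.filter fun x : F => x * (1 - x) = s).card : A) =
      quadChar F A (1 - 4 * s) + 1 := by
    intro s
    have h1 := quadraticChar_card_sqrts hch (1 - 4 * s)
    have h2 : (Finset.univ.filter fun x : F => x * (1 - x) = s).card =
        {x : F | x ^ 2 = 1 - 4 * s}.toFinset.card := by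
      refine Finset.card_nbij' (fun x => 1 - 2 * x) (fun x => (1 - x) / 2) ?_ ?_ ?_ ?_
      · intro x hx
        simp only [Finset.coe_filter, Finset.mem_univ, true_and, Set.mem_ofPred_eq] at hx
        simp only [Set.coe_toFinset, Set.mem_ofPred_eq]
        rw [← hx]; ring
      · intro x hx
        simp only [Set.coe_toFinset, Set.mem_ofPred_eq] at hx
        simp only [Finset.coe_filter, Finset.mem_univ, true_and, Set.mem_ofPred_eq]
        apply mul_left_cancel₀ h4
        have : 4 * s = 1 - x ^ 2 := by rw [hx]; ring
        rw [this]; field_simp; ring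
      · intro x _; field_simp; ring
      · intro x _; field_simp; ring
    have h3 : (((Finset.univ.filter fun x : F => x * (1 - x) = s).card : ℤ) : A) =
        ((quadraticChar F (1 - 4 * s) + 1 : ℤ) : A) := by rw [h2, h1]
    rw [Int.cast_natCast, Int.cast_add, Int.cast_one] at h3
    rw [h3, quadChar, MulChar.ringHomComp_apply, eq_intCast]
  have h5 : jacobiSum a a =
      ∑ s, ((Finset.univ.filter fun x : F => x * (1 - x) = s).card : A) * a s := by
    rw [jacobiSum, ← Finset.sum_fiberwise Finset.univ (fun x : F => x * (1 - x))]
    refine Finset.sum_congr rfl fun s _ => ?_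
    rw [Finset.sum_congr rfl (g := fun _ => a s) fun x hx => by
      rw [← map_mul, (Finset.mem_filter.1 hx).2]]
    simp
  rw [h5]
  simp_rw [hcount, add_mul, one_mul]
  rw [Finset.sum_add_distrib, h, add_zero, jacobiSum, Finset.mul_sum,
    ← Equiv.sum_comp (Equiv.mulLeft₀ 4⁻¹ (inv_ne_zero h4))]
  refine Finset.sum_congr rfl fun x _ => ?_
  rw [Equiv.mulLeft₀_apply, mul_inv_cancel_left₀ h4, map_mul, MulChar.inv_apply']
  ring

/-- The Jacobi sum of `ρ η` and `ρ ψ`, with `ρ` the quadratic character, in terms of Jacobi sums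
of `η` and `ψ`. In the language of Gauss sums, the Davenport-Hasse relation removes the factors `ρ`;
here the cocycle relation takes its place. -/
lemma jacobiSum_quadChar_mul (hF : (2 : F) ≠ 0) {e f : MulChar F A}
    (he : ∑ v, e v = 0) (hf : ∑ v, f v = 0) (he' : ∑ v, e⁻¹ v = 0) (hf' : ∑ v, f⁻¹ v = 0)
    (hr : ∑ v, quadChar F A v = 0) (h1 : ∑ v : F, (1 : MulChar F A) v = 0)
    (hre : ∑ v, (quadChar F A * f) v = 0) :
    jacobiSum (quadChar F A * e) (quadChar F A * f) =
      quadChar F A (-1) * (e⁻¹ 4 * f⁻¹ 4) *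
        (jacobiSum e f * jacobiSum e⁻¹ e⁻¹ * jacobiSum f⁻¹ f⁻¹) := by
  set r := quadChar F A with hrdef
  have hrr : r * r = 1 := quadChar_mul_self
  have hri : r⁻¹ = r := inv_eq_of_mul_eq_one_left hrr
  have h4 : (4 : F) ≠ 0 := by
    rw [show (4 : F) = 2 * 2 by norm_num]; exact mul_ne_zero hF hF
  have hval : ∀ g : MulChar F A, g 4 * g⁻¹ 4 = 1 := fun g => by
    rw [← MulChar.mul_apply, mul_inv_cancel, MulChar.one_apply (isUnit_iff_ne_zero.2 h4)]
  have hsq : r (-1) * r (-1) = 1 := by rw [← map_mul]; simp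
  have hdup : ∀ {g : MulChar F A}, ∑ v, g⁻¹ v = 0 →
      g⁻¹ 4 * jacobiSum g⁻¹ g⁻¹ = r (-1) * jacobiSum r (r * g) := by
    intro g hg
    rw [jacobiSum_self hg hF, inv_inv, ← mul_assoc, mul_comm (g⁻¹ 4), hval, one_mul,
      ← hrdef, jacobiSum_comm, jacobiSum_eq_mul_jacobiSum_inv, mul_inv, inv_inv, hri]
  have hc1 : jacobiSum r (r * e) * jacobiSum e f = jacobiSum r f * jacobiSum (r * e) (r * f) := by
    have h := jacobiSum_cocycle (a := r * e) (b := r) (c := f)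
      (by rwa [mul_right_comm, hrr, one_mul]) hre
    rwa [mul_right_comm, hrr, one_mul, jacobiSum_comm (r * e) r] at h
  have hc2 : jacobiSum r f * jacobiSum r (r * f) = r (-1) := by
    have h := jacobiSum_cocycle (a := r) (b := r) (c := f) (by rwa [hrr]) hre
    have h2 := jacobiSum_inv_right hr
    rw [hri] at h2
    rw [hrr, jacobiSum_one_left hf, h2] at h
    rw [← h]; ring
  calc jacobiSum (r * e) (r * f)
      = jacobiSum (r * e) (r * f) * (r (-1) * r (-1)) * (r (-1) * r (-1)) := by rw [hsq]; ring
    _ = r (-1) * (r (-1) * r (-1)) *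
          (jacobiSum r f * jacobiSum (r * e) (r * f) * jacobiSum r (r * f)) := by
        nth_rewrite 4 [← hc2]; ring
    _ = r (-1) * jacobiSum e f *
          ((r (-1) * jacobiSum r (r * e)) * (r (-1) * jacobiSum r (r * f))) := by
        rw [← hc1]; ring
    _ = _ := by rw [← hdup he', ← hdup hf']; ring

end JacobiSums

/-! ### Powers of a unit congruent to one -/

section Unipotent
variable {A : Type*} [CommRing A]

lemma natCast_eq_of_modEq {l a b : ℕ} (hA : (l : A) = 0) (h : a ≡ b [MOD l]) :
    (a : A) = b := by
  obtain ⟨k, hk⟩ := (Nat.modEq_iff_dvd.1 h)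
  have : ((b : ℤ) : A) = ((a + l * k : ℤ) : A) := by rw [← hk]; congr 1; ring
  push_cast at this
  rw [this, hA, zero_mul, add_zero]

lemma val_zpow_of_mul_self_eq_zero {u : Aˣ} {s : A} (hs : s * s = 0) (hu : (u : A) = 1 + s)
    (f : ℤ) : ((u ^ f : Aˣ) : A) = 1 + f * s := by
  have hinv : ((u⁻¹ : Aˣ) : A) = 1 - s := by
    have h1 : ((u⁻¹ : Aˣ) : A) * u = 1 := Units.inv_mul u
    rw [hu] at h1
    linear_combination (1 - s) * h1 + ((u⁻¹ : Aˣ) : A) * hs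
  induction f with
  | zero => simp
  | succ k ih =>
    rw [zpow_add_one, Units.val_mul, ih, hu]; push_cast
    linear_combination (k : A) * hs
  | pred k ih =>
    rw [zpow_sub_one, Units.val_mul, ih, hinv]; push_cast
    linear_combination (k : A) * hs

variable {l : ℕ} {z : Aˣ}

lemma val_pow_prime (hl : l.Prime) (hA : (l : A) = 0) (z : Aˣ) :
    ((z ^ l : Aˣ) : A) = 1 + ((z : A) - 1) ^ l := by
  obtain ⟨r, hr⟩ := exists_add_pow_prime_eq hl (1 : A) ((z : A) - 1)
  rw [add_sub_cancel, one_pow, hA, zero_mul, zero_mul, zero_mul, add_zero] at hr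
  rw [Units.val_pow_eq_pow_val, hr]

lemma val_pow_mul_sub_one_pow (hz : ((z : A) - 1) ^ (l + 1) = 0) (k : ℕ) :
    (z : A) ^ k * ((z : A) - 1) ^ l = ((z : A) - 1) ^ l := by
  induction k with
  | zero => simp
  | succ k ih =>
    have h1 : (z : A) * ((z : A) - 1) ^ l = ((z : A) - 1) ^ l := by linear_combination hz
    rw [pow_succ, mul_assoc, h1, ih]

lemma sub_one_pow_mul_self (hl : 0 < l) (hz : ((z : A) - 1) ^ (l + 1) = 0) :
    ((z : A) - 1) ^ l * ((z : A) - 1) ^ l = 0 := by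
  rw [← pow_add, show l + l = (l + 1) + (l - 1) by omega, pow_add, hz, zero_mul]

/-- Modulo `(z - 1) ^ (l + 1)` and the prime `l`, the power `z ^ (r + l f)` is
`(1 + (z - 1)) ^ r * (1 + f (z - 1) ^ l)`. -/
lemma val_zpow_eq_sum (hl : l.Prime) (hA : (l : A) = 0)
    (hz : ((z : A) - 1) ^ (l + 1) = 0) (a : ℤ) :
    ((z ^ a : Aˣ) : A) =
      ∑ i ∈ Finset.range l, (((a % l).toNat.choose i : ℕ) : A) * ((z : A) - 1) ^ i +
        ((a / l : ℤ) : A) * ((z : A) - 1) ^ l := by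
  set t : A := (z : A) - 1 with ht
  have hl0 : (0 : ℤ) < l := by exact_mod_cast hl.pos
  obtain ⟨r, hr⟩ := Int.eq_ofNat_of_zero_le (Int.emod_nonneg a hl0.ne')
  have hrl : r < l := by have := Int.emod_lt_of_pos a hl0; omega
  have hzt : (z : A) = t + 1 := by rw [ht]; ring
  have hpow : (z : A) ^ r = ∑ i ∈ Finset.range l, ((r.choose i : ℕ) : A) * t ^ i := by
    rw [hzt, add_pow, ← Finset.sum_subset (Finset.range_subset_range.2 hrl)]
    · exact Finset.sum_congr rfl fun i _ => by rw [one_pow]; ring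
    · intro i _ hi
      rw [Finset.mem_range, not_lt] at hi
      rw [Nat.choose_eq_zero_of_lt (by omega), Nat.cast_zero, zero_mul]
  have hza : z ^ a = z ^ r * (z ^ l) ^ (a / l) := by
    rw [← zpow_natCast z l, ← zpow_natCast z r, ← zpow_mul, ← zpow_add]
    congr 1
    have := Int.emod_add_mul_ediv a l
    rw [hr] at this
    exact this.symm
  rw [hza, Units.val_mul, val_zpow_of_mul_self_eq_zero (sub_one_pow_mul_self hl.pos hz)
    (val_pow_prime hl hA z), hr,
    Int.toNat_natCast, ← hpow, Units.val_pow_eq_pow_val]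
  linear_combination ((a / l : ℤ) : A) * val_pow_mul_sub_one_pow hz r

lemma val_zpow_sub_one_pow_eq_zero {m : ℕ} (hz : ((z : A) - 1) ^ m = 0) (n : ℤ) :
    (((z ^ n : Aˣ) : A) - 1) ^ m = 0 := by
  have key : (z : A) - 1 ∣ ((z ^ n : Aˣ) : A) - 1 := by
    have hnat : ∀ k : ℕ, (z : A) - 1 ∣ ((z ^ k : Aˣ) : A) - 1 := fun k => by
      rw [Units.val_pow_eq_pow_val]; exact sub_one_dvd_pow_sub_one _ _
    obtain ⟨k, rfl | rfl⟩ := n.eq_nat_or_neg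
    · rw [zpow_natCast]; exact hnat k
    · rw [zpow_neg, zpow_natCast]
      obtain ⟨c, hc⟩ := hnat k
      refine ⟨-c * ((z ^ k)⁻¹ : Aˣ), ?_⟩
      have h1 : ((z ^ k : Aˣ) : A) * ((z ^ k)⁻¹ : Aˣ) = 1 := Units.mul_inv _
      linear_combination (-(((z ^ k)⁻¹ : Aˣ) : A)) * hc + h1
  obtain ⟨c, hc⟩ := key
  rw [hc, mul_pow, hz, zero_mul]

end Unipotent

/-! ### The index -/

section Index
variable {F : Type*} [Field F] {γ : Fˣ}

/-- The index of `0` is the infimum of the empty set. -/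
lemma ind_zero : ind γ (0 : F) = 0 := by
  have : {k : ℕ | (γ : F) ^ k = 0} = ∅ :=
    Set.eq_empty_of_forall_notMem fun k hk => pow_ne_zero k γ.ne_zero hk
  rw [ind, this, Nat.sInf_empty]

lemma ind_one : ind γ (1 : F) = 0 :=
  Nat.le_zero.1 (Nat.sInf_le (by simp))

variable [Fintype F]

lemma pow_ind (hγ : ∀ x : Fˣ, x ∈ Subgroup.zpowers γ) {v : F} (hv : v ≠ 0) :
    (γ : F) ^ ind γ v = v := by
  obtain ⟨k, hk⟩ := (mem_powers_iff_mem_zpowers.2 (hγ (Units.mk0 v hv)))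
  exact Nat.sInf_mem (s := {k : ℕ | (γ : F) ^ k = v}) ⟨k, by
    have := congrArg Units.val hk
    simpa using this⟩

lemma orderOf_generator (hγ : ∀ x : Fˣ, x ∈ Subgroup.zpowers γ) :
    orderOf γ = Fintype.card F - 1 := by
  classical
  rw [orderOf_eq_card_of_forall_mem_zpowers hγ, Nat.card_eq_fintype_card, Fintype.card_units]

lemma pow_eq_pow_iff (hγ : ∀ x : Fˣ, x ∈ Subgroup.zpowers γ) {a b : ℕ} :
    (γ : F) ^ a = (γ : F) ^ b ↔ a ≡ b [MOD Fintype.card F - 1] := by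
  rw [← orderOf_generator hγ, ← pow_eq_pow_iff_modEq, ← Units.val_inj]
  simp

lemma ind_mul (hγ : ∀ x : Fˣ, x ∈ Subgroup.zpowers γ) {u v : F} (hu : u ≠ 0) (hv : v ≠ 0) :
    ind γ (u * v) ≡ ind γ u + ind γ v [MOD Fintype.card F - 1] := by
  rw [← pow_eq_pow_iff hγ, pow_add, pow_ind hγ hu, pow_ind hγ hv, pow_ind hγ (mul_ne_zero hu hv)]

lemma ind_lt (hγ : ∀ x : Fˣ, x ∈ Subgroup.zpowers γ) {v : F} (hv : v ≠ 0) :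
    ind γ v < Fintype.card F - 1 := by
  have hpos : 0 < Fintype.card F - 1 := by
    have := Fintype.one_lt_card (α := F); omega
  refine lt_of_le_of_lt (Nat.sInf_le ?_) (Nat.mod_lt (ind γ v) hpos)
  change (γ : F) ^ _ = v
  rw [(pow_eq_pow_iff hγ).2 (Nat.mod_modEq _ _), pow_ind hγ hv]

lemma sum_ind {A : Type*} [AddCommMonoid A] (hγ : ∀ x : Fˣ, x ∈ Subgroup.zpowers γ)
    [DecidableEq F] (g : ℕ → A) :
    ∑ v ∈ Finset.univ.erase (0 : F), g (ind γ v) = ∑ k ∈ Finset.range (Fintype.card F - 1), g k := by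
  refine Finset.sum_nbij' (ind γ) (fun k => (γ : F) ^ k) ?_ ?_ ?_ ?_ ?_
  · intro v hv
    exact Finset.mem_range.2 (ind_lt hγ (Finset.ne_of_mem_erase hv))
  · intro k _
    simp
  · intro v hv
    exact pow_ind hγ (Finset.ne_of_mem_erase hv)
  · intro k hk
    have h0 : (γ : F) ^ k ≠ 0 := pow_ne_zero k γ.ne_zero
    exact ((pow_eq_pow_iff hγ).1 (pow_ind hγ h0)).eq_of_lt_of_lt (ind_lt hγ h0)
      (Finset.mem_range.1 hk)
  · intro v _; rfl

variable {A : Type*} [CommRing A] {l : ℕ}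

lemma sum_range_periodic (hA : (l : A) = 0) {g : ℕ → A} (hg : ∀ k, g (l + k) = g k) {N : ℕ}
    (hN : l ^ 2 ∣ N) : ∑ k ∈ Finset.range N, g k = 0 := by
  obtain ⟨s, rfl⟩ := hN
  have key : ∀ m, ∑ k ∈ Finset.range (l * m), g k = m * ∑ k ∈ Finset.range l, g k := by
    intro m
    induction m with
    | zero => simp
    | succ m ih =>
      rw [Nat.mul_succ, add_comm, Finset.sum_range_add]
      simp_rw [hg]
      rw [ih]; push_cast; ring
  rw [pow_two, mul_assoc, key, Nat.cast_mul, hA, zero_mul, zero_mul]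

/-- A function of the index modulo `l` has sum `0`: each residue occurs a multiple of `l` times. The
value at `v = 0`, where the index is `0` by convention, drops out by `g 0 = 0`. -/
lemma sum_periodic_ind (hγ : ∀ x : Fˣ, x ∈ Subgroup.zpowers γ) (hA : (l : A) = 0)
    (hq : l ^ 2 ∣ Fintype.card F - 1) {g : ℕ → A} (hg : ∀ k, g (l + k) = g k) (hg0 : g 0 = 0) :
    ∑ v : F, g (ind γ v) = 0 := by
  classical
  rw [← Finset.sum_erase (a := 0) _ (by rw [ind_zero, hg0]), sum_ind hγ,
    sum_range_periodic hA hg hq]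

lemma natCast_ind_mul (hγ : ∀ x : Fˣ, x ∈ Subgroup.zpowers γ) (hA : (l : A) = 0)
    (hq : l ^ 2 ∣ Fintype.card F - 1) {u v : F} (hu : u ≠ 0) (hv : v ≠ 0) :
    (ind γ (u * v) : A) = ind γ u + ind γ v := by
  have := natCast_eq_of_modEq hA
    ((ind_mul hγ hu hv).of_dvd ((dvd_pow_self l two_ne_zero).trans hq))
  rw [this, Nat.cast_add]

lemma natCast_ind_neg_one (h2 : IsUnit (2 : A)) (hγ : ∀ x : Fˣ, x ∈ Subgroup.zpowers γ)
    (hA : (l : A) = 0)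
    (hq : l ^ 2 ∣ Fintype.card F - 1) : (ind γ (-1 : F) : A) = 0 := by
  have := natCast_ind_mul (A := A) hγ hA hq (u := -1) (v := -1) (by simp) (by simp)
  rw [neg_one_mul, neg_neg, ind_one, Nat.cast_zero, ← two_mul] at this
  exact (h2.mul_right_eq_zero).1 this.symm

/-- With `λ v` the index of `v`, the substitution `v ↦ v⁻¹` takes `λ v * λ (v + 1)` to
`-λ v * (λ (v + 1) - λ v)`. -/
lemma sum_ind_mul_ind_add_one (h2 : IsUnit (2 : A)) (hγ : ∀ x : Fˣ, x ∈ Subgroup.zpowers γ)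
    (hA : (l : A) = 0)
    (hq : l ^ 2 ∣ Fintype.card F - 1) :
    ∑ v : F, (ind γ v : A) * (ind γ (v + 1) : A) = 0 := by
  have hsq : ∑ v : F, (ind γ v : A) ^ 2 = 0 :=
    sum_periodic_ind hγ hA hq (g := fun k => (k : A) ^ 2) (fun k => by simp [hA]) (by simp)
  have hinv : ∀ v : F, (ind γ v⁻¹ : A) = -ind γ v := by
    intro v
    rcases eq_or_ne v 0 with rfl | hv
    · simp [ind_zero]
    · have := natCast_ind_mul (A := A) hγ hA hq (inv_ne_zero hv) hv
      rw [inv_mul_cancel₀ hv, ind_one, Nat.cast_zero] at this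
      linear_combination -this
  have hflip : ∀ v : F, (ind γ v⁻¹ : A) * (ind γ (v⁻¹ + 1) : A) =
      (ind γ v : A) ^ 2 - (ind γ v : A) * (ind γ (v + 1) : A) := by
    intro v
    rcases eq_or_ne v 0 with rfl | hv
    · simp [ind_zero]
    rcases eq_or_ne (v + 1) 0 with hv1 | hv1
    · rw [hinv, eq_neg_of_add_eq_zero_left hv1, natCast_ind_neg_one h2 hγ hA hq]; ring
    · rw [show v⁻¹ + 1 = v⁻¹ * (v + 1) by field_simp; ring,
        natCast_ind_mul hγ hA hq (inv_ne_zero hv) hv1, hinv]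
      ring
  have h1 : ∑ v : F, (ind γ v : A) * (ind γ (v + 1) : A) =
      ∑ v : F, (ind γ v⁻¹ : A) * (ind γ (v⁻¹ + 1) : A) :=
    (Equiv.sum_comp (Equiv.inv F) fun v => (ind γ v : A) * (ind γ (v + 1) : A)).symm
  simp_rw [hflip] at h1
  rw [Finset.sum_sub_distrib, hsq, zero_sub] at h1
  refine (h2.mul_right_eq_zero).1 ?_
  linear_combination h1

end Index

/-! ### Jacobi sums of order `l²` -/

section OrderSq
variable {F : Type*} [Field F] [Fintype F] {γ : Fˣ} {A : Type*} [CommRing A] {l : ℕ}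

/-- The expression `cExpr` over an arbitrary commutative ring. -/
noncomputable def coeffExpr (γ : Fˣ) (l : ℕ) (n : ℤ) (x : A) : A :=
  -1 + ∑ i ∈ Finset.Icc 3 l, (c γ l i n : A) * (x - 1) ^ i

/-- The exponent `ind v + n ind (v + 1)` of the term `v` of a Jacobi sum. -/
noncomputable def expo (γ : Fˣ) (n : ℤ) (v : F) : ℤ := ind γ v + n * ind γ (v + 1)

open Classical in
/-- The elements `v ≠ 0, -1` of `F`. -/
noncomputable def dom (F : Type*) [Field F] [Fintype F] : Finset F :=
  Finset.univ.filter fun v => v ≠ 0 ∧ v + 1 ≠ 0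

lemma mem_dom {v : F} : v ∈ dom F ↔ v ≠ 0 ∧ v + 1 ≠ 0 := by simp [dom]

lemma sum_dom {f : F → A} (h0 : f 0 = 0) (h1 : f (-1) = 0) : ∑ v ∈ dom F, f v = ∑ v, f v := by
  refine Finset.sum_subset (Finset.subset_univ _) fun v _ hv => ?_
  rw [mem_dom, not_and_or, not_not, not_not] at hv
  rcases hv with rfl | hv
  · exact h0
  · rw [eq_neg_of_add_eq_zero_left hv, h1]

lemma natCast_card_eq_one (hA : (l : A) = 0) (hq : l ^ 2 ∣ Fintype.card F - 1) :
    (Fintype.card F : A) = 1 := by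
  obtain ⟨s, hs⟩ := hq
  have : Fintype.card F = l ^ 2 * s + 1 := by
    have := Fintype.card_pos (α := F); omega
  rw [this]; push_cast; rw [hA]; ring

lemma natCast_card_dom (hA : (l : A) = 0) (hq : l ^ 2 ∣ Fintype.card F - 1) :
    ((dom F).card : A) = -1 := by
  classical
  have h : dom F = (Finset.univ.erase 0).erase (-1) := by
    ext v
    rw [mem_dom, Finset.mem_erase, Finset.mem_erase, ne_eq (a := v) (b := -1), eq_neg_iff_add_eq_zero]
    simp [and_comm]
  have h1 : (dom F).card + 2 = Fintype.card F := by
    have := Finset.card_erase_add_one (s := Finset.univ) (Finset.mem_univ (0 : F))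
    have := Finset.card_erase_add_one (s := Finset.univ.erase (0 : F)) (a := -1) (by simp)
    rw [h]
    rw [← Finset.card_univ]
    omega
  have h2 := congrArg (Nat.cast (R := A)) h1
  rw [natCast_card_eq_one hA hq] at h2
  push_cast at h2
  linear_combination h2

/-- The summand vanishes at `v = 0` and at `v = -1`, so that the sum may be extended to `F`. -/
lemma sum_expo (h2 : IsUnit (2 : A)) (hγ : ∀ x : Fˣ, x ∈ Subgroup.zpowers γ) (hA : (l : A) = 0)
    (hq : l ^ 2 ∣ Fintype.card F - 1) (n : ℤ) : ∑ v ∈ dom F, (expo γ n v : A) = 0 := by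
  have hs : ∑ v : F, (ind γ v : A) = 0 :=
    sum_periodic_ind hγ hA hq (g := fun k => (k : A)) (fun k => by simp [hA]) (by simp)
  have hs' : ∑ v : F, (ind γ (v + 1) : A) = 0 :=
    (Equiv.sum_comp (Equiv.addRight (1 : F)) fun v => (ind γ v : A)).trans hs
  simp only [expo]; push_cast
  rw [sum_dom (by simp [ind_zero, ind_one])
    (by simp [ind_zero, natCast_ind_neg_one h2 hγ hA hq]),
    Finset.sum_add_distrib, ← Finset.mul_sum, hs, hs', mul_zero, add_zero]

lemma sum_expo_sq (h2 : IsUnit (2 : A)) (hγ : ∀ x : Fˣ, x ∈ Subgroup.zpowers γ)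
    (hA : (l : A) = 0) (hq : l ^ 2 ∣ Fintype.card F - 1) (n : ℤ) :
    ∑ v ∈ dom F, (expo γ n v : A) ^ 2 = 0 := by
  have hs : ∑ v : F, (ind γ v : A) ^ 2 = 0 :=
    sum_periodic_ind hγ hA hq (g := fun k => (k : A) ^ 2) (fun k => by simp [hA]) (by simp)
  have hs' : ∑ v : F, (ind γ (v + 1) : A) ^ 2 = 0 :=
    (Equiv.sum_comp (Equiv.addRight (1 : F)) fun v => (ind γ v : A) ^ 2).trans hs
  have he : ∀ v : F, (expo γ n v : A) ^ 2 = (ind γ v : A) ^ 2 +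
      2 * n * ((ind γ v : A) * (ind γ (v + 1) : A)) + (n : A) ^ 2 * (ind γ (v + 1) : A) ^ 2 := by
    intro v; simp only [expo]; push_cast; ring
  simp_rw [he]
  rw [sum_dom (by simp [ind_zero, ind_one])
    (by simp [ind_zero, natCast_ind_neg_one h2 hγ hA hq]),
    Finset.sum_add_distrib, Finset.sum_add_distrib, ← Finset.mul_sum, ← Finset.mul_sum, hs, hs',
    sum_ind_mul_ind_add_one h2 hγ hA hq]
  ring

/-- The residue of `expo γ n v` modulo `l` takes the value `m` for `jacobiCoeff γ l n m` of the
`v ≠ 0, -1`. -/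
lemma sum_emod_expo (hl : 0 < l) (n : ℤ) (f : ℕ → A) :
    ∑ v ∈ dom F, f (expo γ n v % l).toNat =
      ∑ m ∈ Finset.range l, f m * (jacobiCoeff γ l n m : A) := by
  classical
  have hl' : (0 : ℤ) < l := by exact_mod_cast hl
  rw [← Finset.sum_fiberwise_of_maps_to (t := Finset.range l)
    (g := fun v => (expo γ n v % l).toNat) (fun v _ => by
      have := Int.emod_lt_of_pos (expo γ n v) hl'
      have := Int.emod_nonneg (expo γ n v) hl'.ne'
      rw [Finset.mem_range]; omega)]
  refine Finset.sum_congr rfl fun m hm => ?_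
  rw [Finset.sum_congr rfl (g := fun _ => f m) fun v hv => by rw [(Finset.mem_filter.1 hv).2],
    Finset.sum_const, nsmul_eq_mul, mul_comm, jacobiCoeff]
  congr 3
  ext v
  rw [Finset.mem_filter, mem_dom, Finset.mem_filter, and_assoc]
  have hm' : (m : ℤ) % l = m := Int.emod_eq_of_lt (by omega) (by
    have := Finset.mem_range.1 hm; omega)
  have := Int.emod_nonneg (expo γ n v) hl'.ne'
  simp only [Finset.mem_univ, true_and]
  refine and_congr_right fun _ => and_congr_right fun _ => ?_
  rw [Int.ModEq, hm', ← expo]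
  omega

/-- Reducing `ind v` and `ind (v + 1)` modulo `l²` changes the quotient `⌊expo γ n v / l⌋` by a
multiple of `l`. -/
lemma sum_ediv_expo (hl : 0 < l) (hA : (l : A) = 0) (n : ℤ) :
    ∑ v ∈ dom F, ((expo γ n v / l : ℤ) : A) = (S γ l n : A) := by
  classical
  have hl' : (0 : ℤ) < l := by exact_mod_cast hl
  have hl2 : 0 < l ^ 2 := by positivity
  let g : F → ℕ × ℕ := fun v => (ind γ v % l ^ 2, ind γ (v + 1) % l ^ 2)
  rw [S, ← Finset.sum_product', Int.cast_sum, ← Finset.sum_fiberwise_of_maps_to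
    (t := Finset.range (l ^ 2) ×ˢ Finset.range (l ^ 2)) (g := g) (fun v _ => by
      simp [g, Nat.mod_lt _ hl2])]
  refine Finset.sum_congr rfl fun p hp => ?_
  obtain ⟨h, k⟩ := p
  rw [Finset.mem_product, Finset.mem_range, Finset.mem_range] at hp
  rw [Finset.sum_congr rfl (g := fun _ => (((h + n * k) / l : ℤ) : A)) ?_, Finset.sum_const,
    nsmul_eq_mul, Int.cast_mul, Int.cast_natCast, cyclotomicNumber]
  · congr 3
    ext v
    rw [Finset.mem_filter, mem_dom, Finset.mem_filter, and_assoc]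
    simp only [Finset.mem_univ, true_and, g, Prod.mk.injEq]
    refine and_congr_right fun _ => and_congr_right fun _ => ?_
    rw [Nat.ModEq, Nat.ModEq, Nat.mod_eq_of_lt hp.1, Nat.mod_eq_of_lt hp.2]
  · intro v hv
    have hv := (Finset.mem_filter.1 hv).2
    simp only [g, Prod.mk.injEq] at hv
    have h1 := Nat.mod_add_div (ind γ v) (l ^ 2)
    have h2 := Nat.mod_add_div (ind γ (v + 1)) (l ^ 2)
    rw [hv.1] at h1
    rw [hv.2] at h2
    have h3 : expo γ n v = h + n * k +
        l * (l * ((ind γ v / l ^ 2 : ℕ) + n * (ind γ (v + 1) / l ^ 2 : ℕ))) := by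
      zify at h1 h2
      push_cast
      linear_combination -h1 - n * h2 + expo.eq_1 γ n v
    rw [h3, Int.add_mul_ediv_left _ _ hl'.ne']
    push_cast
    rw [hA]; ring

/-- The congruence for the Jacobi sums of order `l²`: after expansion in powers of `z - 1`, the
coefficient of `(z - 1) ^ 0` is `q - 2 = -1`, and those of `z - 1` and `(z - 1) ^ 2` vanish. -/
lemma sum_zpow_expo (hl : l.Prime) (hl3 : 3 ≤ l) (hγ : ∀ x : Fˣ, x ∈ Subgroup.zpowers γ)
    (hA : (l : A) = 0) (h2 : IsUnit (2 : A)) (hq : l ^ 2 ∣ Fintype.card F - 1) {z : Aˣ}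
    (hz : ((z : A) - 1) ^ (l + 1) = 0) (n : ℤ) :
    ∑ v ∈ dom F, ((z ^ expo γ n v : Aˣ) : A) = coeffExpr γ l n (z : A) := by
  have hl' : (0 : ℤ) < l := by exact_mod_cast hl.pos
  have hcast : ∀ v : F, (((expo γ n v % l).toNat : ℕ) : A) = expo γ n v := by
    intro v
    have h1 : (((expo γ n v % l).toNat : ℕ) : A) = ((expo γ n v % l : ℤ) : A) := by
      rw [← Int.cast_natCast, Int.toNat_of_nonneg (Int.emod_nonneg _ hl'.ne')]
    have h3 := congrArg (Int.cast (R := A)) (Int.emod_add_mul_ediv (expo γ n v) l)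
    push_cast at h3
    rw [h1, ← h3, hA]; ring
  -- the coefficients of `1`, `z - 1` and `(z - 1) ^ 2`
  have hC0 : ∑ v ∈ dom F, ((((expo γ n v % l).toNat.choose 0 : ℕ)) : A) = -1 := by
    simp [natCast_card_dom (F := F) hA hq]
  have hC1 : ∑ v ∈ dom F, ((((expo γ n v % l).toNat.choose 1 : ℕ)) : A) = 0 := by
    simp_rw [Nat.choose_one_right, hcast]
    exact sum_expo h2 hγ hA hq n
  have hC2 : ∑ v ∈ dom F, ((((expo γ n v % l).toNat.choose 2 : ℕ)) : A) = 0 := by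
    have hch : ∀ v : F, (2 : A) * (((expo γ n v % l).toNat.choose 2 : ℕ) : A) =
        (expo γ n v : A) ^ 2 - expo γ n v := by
      intro v
      rw [← hcast v]
      generalize (expo γ n v % l).toNat = r
      have h3 : r.choose 2 * 2 + r = r ^ 2 := by
        induction r with
        | zero => rfl
        | succ r ih => rw [Nat.choose_succ_succ', Nat.choose_one_right]; linarith
      have h4 := congrArg (Nat.cast (R := A)) h3
      push_cast at h4
      linear_combination h4
    refine (h2.mul_right_eq_zero).1 ?_
    rw [Finset.mul_sum]
    simp_rw [hch]
    rw [Finset.sum_sub_distrib, sum_expo_sq h2 hγ hA hq, sum_expo h2 hγ hA hq, sub_zero]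
  simp_rw [val_zpow_eq_sum hl hA hz]
  rw [Finset.sum_add_distrib, Finset.sum_comm]
  simp_rw [← Finset.sum_mul]
  rw [sum_ediv_expo hl.pos hA]
  rw [← Finset.sum_range_add_sum_Ico _ hl3]
  rw [Finset.sum_range_succ, Finset.sum_range_succ, Finset.sum_range_one, hC0, hC1, hC2, coeffExpr,
    ← Finset.Ico_succ_right_eq_Icc, Order.succ_eq_add_one, Finset.sum_Ico_succ_top hl3]
  rw [c, if_pos rfl, pow_zero, mul_one, zero_mul, zero_mul, add_zero, add_zero, add_assoc]
  congr 2
  refine Finset.sum_congr rfl fun i hi => ?_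
  rw [c, if_neg (Finset.mem_Ico.1 hi).2.ne,
    sum_emod_expo (γ := γ) hl.pos n fun m => ((m.choose i : ℕ) : A)]
  push_cast
  rfl

/-- For an exponent `l * n` the term of `v` is `z ^ ind v + n * ind (v + 1) * (z - 1) ^ l`. -/
lemma sum_zpow_expo_mul (hl : l.Prime) (hγ : ∀ x : Fˣ, x ∈ Subgroup.zpowers γ)
    (hA : (l : A) = 0) (hq : l ^ 2 ∣ Fintype.card F - 1) {z : Aˣ}
    (hz : ((z : A) - 1) ^ (l + 1) = 0) (n : ℤ) :
    ∑ v ∈ dom F, ((z ^ expo γ (l * n) v : Aˣ) : A) =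
      ∑ v ∈ dom F, ((z ^ expo γ 0 v : Aˣ) : A) := by
  have hterm : ∀ v : F, ((z ^ expo γ (l * n) v : Aˣ) : A) = ((z ^ expo γ 0 v : Aˣ) : A) +
      n * ((z : A) - 1) ^ l * (ind γ (v + 1) : A) := by
    intro v
    have h1 : z ^ expo γ (l * n) v = z ^ ind γ v * (z ^ l) ^ (n * ind γ (v + 1)) := by
      rw [← zpow_natCast z l, ← zpow_natCast z (ind γ v), ← zpow_mul, ← zpow_add, expo, mul_assoc]
    have h2 : z ^ expo γ 0 v = z ^ ind γ v := by
      rw [← zpow_natCast z (ind γ v), expo, zero_mul, add_zero]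
    rw [h1, h2, Units.val_mul, val_zpow_of_mul_self_eq_zero (sub_one_pow_mul_self hl.pos hz)
      (val_pow_prime hl hA z), Units.val_pow_eq_pow_val]
    push_cast
    linear_combination (n : A) * (ind γ (v + 1) : A) * val_pow_mul_sub_one_pow hz (ind γ v)
  have hs : ∑ v : F, (ind γ v : A) = 0 :=
    sum_periodic_ind hγ hA hq (g := fun k => (k : A)) (fun k => by simp [hA]) (by simp)
  have hs' : ∑ v : F, (ind γ (v + 1) : A) = 0 :=
    (Equiv.sum_comp (Equiv.addRight (1 : F)) fun v => (ind γ v : A)).trans hs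
  simp_rw [hterm]
  rw [Finset.sum_add_distrib, ← Finset.mul_sum, sum_dom (f := fun v => (ind γ (v + 1) : A))
    (by simp [ind_one]) (by simp [ind_zero]), hs', mul_zero, add_zero]

end OrderSq

/-! ### Jacobi sums of order `2l²` in the residue ring -/

section Setting
variable {F : Type*} [Field F] [Fintype F] {γ : Fˣ} {A : Type*} [CommRing A] {l : ℕ}

lemma zpow_mulChar_apply (hγ : ∀ x : Fˣ, x ∈ Subgroup.zpowers γ) {X : MulChar F A} {y : Aˣ}
    (hX : X γ = y) (n : ℤ) {v : F} (hv : v ≠ 0) :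
    (X ^ n) v = ((y ^ (n * ind γ v) : Aˣ) : A) := by
  have hy : X.mulEquivToUnitHom γ = y := Units.ext (by simpa using hX)
  have h1 : (X ^ n) ((γ ^ ind γ v : Fˣ) : F) =
      ((X ^ n).mulEquivToUnitHom (γ ^ ind γ v) : A) := by simp
  rw [Units.val_pow_eq_pow_val, pow_ind hγ hv] at h1
  rw [h1, map_zpow, MonoidHom.zpow_apply, map_pow, hy, ← zpow_natCast, ← zpow_mul, mul_comm]

lemma sum_mul_add_one_eq (a b : MulChar F A) :
    ∑ v, a v * b (v + 1) = a (-1) * jacobiSum a b := by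
  rw [jacobiSum, Finset.mul_sum, ← Equiv.sum_comp (Equiv.neg F)]
  refine Finset.sum_congr rfl fun v _ => ?_
  rw [Equiv.neg_apply, ← neg_one_mul v, map_mul, show -1 * v + 1 = 1 - v by ring]
  ring

lemma mulChar_neg_one_mul_self {F A : Type*} [Field F] [CommRing A] (a : MulChar F A) :
    a (-1) * a (-1) = 1 := by
  rw [← map_mul]; simp

lemma mulChar_zpow_two_mul_neg_one {F A : Type*} [Field F] [CommRing A] (X : MulChar F A)
    (n : ℤ) : (X ^ (2 * n)) (-1) = 1 := by
  rw [mul_comm, zpow_mul, zpow_ofNat, pow_two, MulChar.mul_apply, mulChar_neg_one_mul_self]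

lemma jacobiSum_zpow_two_mul_refl (X : MulChar F A) (a b : ℤ) :
    jacobiSum (X ^ (2 * a)) (X ^ b) = jacobiSum (X ^ (2 * a)) (X ^ (-2 * a - b)) := by
  rw [jacobiSum_eq_mul_jacobiSum_inv, mulChar_zpow_two_mul_neg_one, one_mul, ← zpow_add, ← zpow_neg]
  congr 2; ring

lemma mulChar_zpow_congr (hγ : ∀ x : Fˣ, x ∈ Subgroup.zpowers γ) {X : MulChar F A} {y : Aˣ}
    (hX : X γ = y) {N a b : ℤ} (hN : y ^ N = 1) (h : N ∣ a - b) : X ^ a = X ^ b := by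
  obtain ⟨k, hk⟩ := h
  ext u
  rw [zpow_mulChar_apply hγ hX a u.ne_zero, zpow_mulChar_apply hγ hX b u.ne_zero,
    show a = b + N * k by omega, add_mul, zpow_add, mul_assoc, zpow_mul y N, hN, one_zpow, mul_one]

/-- The reflection `n ↦ -1 - n`, which exchanges even and odd `n`. -/
lemma sum_mul_add_one_refl (X : MulChar F A) (n : ℤ) : ∑ v, (X ^ (1 : ℤ)) v * (X ^ n) (v + 1) =
    (X ^ (1 : ℤ)) (-1) * ∑ v, (X ^ (1 : ℤ)) v * (X ^ (-1 - n)) (v + 1) := by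
  rw [sum_mul_add_one_eq, sum_mul_add_one_eq, jacobiSum_eq_mul_jacobiSum_inv, ← zpow_add,
    ← zpow_neg, neg_add, sub_eq_add_neg]

lemma coeffExpr_eq_neg_one {n : ℤ} {x : A} (hx : (x - 1) ^ 3 = 0) : coeffExpr γ l n x = -1 := by
  rw [coeffExpr, Finset.sum_eq_zero, add_zero]
  intro i hi
  obtain ⟨k, rfl⟩ := Nat.exists_eq_add_of_le (Finset.mem_Icc.1 hi).1
  rw [pow_add, hx, zero_mul, mul_zero]

/-- `A` is a ring in which the prime `l` vanishes and `X` is a character of `Fˣ` with values in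
`A` whose value `y` at `γ` behaves as `ζ_{2l²}` does modulo `(1 - ζ_{l²}) ^ (l + 1)`. The last field
includes the trivial character, whose sum is `q - 1`. -/
structure JacobiSetting (γ : Fˣ) (l : ℕ) (X : MulChar F A) (y : Aˣ) : Prop where
  prime : l.Prime
  three_le : 3 ≤ l
  card : 2 * l ^ 2 ∣ Fintype.card F - 1
  gen : ∀ x : Fˣ, x ∈ Subgroup.zpowers γ
  natCast_eq : (l : A) = 0
  apply_gen : X γ = y
  pow_sq : y ^ l ^ 2 = -1
  nilp : (((y ^ 2 : Aˣ) : A) - 1) ^ (l + 1) = 0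
  sum_eq : ∀ n : ℤ, ∑ v, (X ^ n) v = 0

namespace JacobiSetting
variable {X : MulChar F A} {y : Aˣ} (H : JacobiSetting γ l X y)
include H

lemma sq_dvd : l ^ 2 ∣ Fintype.card F - 1 := (dvd_mul_left _ _).trans H.card

lemma odd : Odd l := H.prime.odd_of_ne_two (by have := H.three_le; omega)

lemma isUnit_two : IsUnit (2 : A) := by
  obtain ⟨k, hk⟩ := H.odd
  refine IsUnit.of_mul_eq_one (-(k : A)) ?_
  have := H.natCast_eq
  rw [hk] at this; push_cast at this
  linear_combination -this

lemma two_ne_zero_of_card : (2 : F) ≠ 0 := by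
  intro h
  have h1 : ringChar F = 2 := (Nat.prime_dvd_prime_iff_eq
    (CharP.char_is_prime F (ringChar F)) Nat.prime_two).1 (ringChar.dvd (by exact_mod_cast h))
  have h2 : 2 ∣ Fintype.card F := by
    rw [← Nat.cast_two, ← Nat.cast_two] at h
    rw [← h1]; exact (CharP.cast_eq_zero_iff F (ringChar F) _).1 (FiniteField.cast_card_eq_zero F)
  have h3 : 2 ∣ Fintype.card F - 1 := (dvd_mul_right _ _).trans H.card
  have := Fintype.card_pos (α := F)
  omega

lemma y_pow : y ^ (2 * (l : ℤ) ^ 2) = 1 := by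
  have h : y ^ (2 * l ^ 2) = 1 := by rw [mul_comm, pow_mul, H.pow_sq]; simp
  exact_mod_cast h

lemma y_zpow_congr {a b : ℤ} (h : 2 * (l : ℤ) ^ 2 ∣ a - b) : y ^ a = y ^ b := by
  obtain ⟨k, hk⟩ := h
  rw [show a = b + 2 * (l : ℤ) ^ 2 * k by omega, zpow_add, zpow_mul, H.y_pow, one_zpow, mul_one]

lemma apply (n : ℤ) {v : F} (hv : v ≠ 0) : (X ^ n) v = ((y ^ (n * ind γ v) : Aˣ) : A) :=
  zpow_mulChar_apply H.gen H.apply_gen n hv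

lemma X_zpow_congr {a b : ℤ} (h : 2 * (l : ℤ) ^ 2 ∣ a - b) : X ^ a = X ^ b :=
  mulChar_zpow_congr H.gen H.apply_gen H.y_pow h

lemma X_zpow_sq : X ^ ((l : ℤ) ^ 2) = quadChar F A := by
  classical
  have hns : ¬ IsSquare (γ : F) := by
    rintro ⟨w, hw⟩
    have hw0 : w ≠ 0 := by rintro rfl; simp at hw
    have h1 : (γ : F) ^ 1 = (γ : F) ^ (ind γ w + ind γ w) := by
      rw [pow_add, pow_ind H.gen hw0, pow_one, hw]
    have h2 := ((pow_eq_pow_iff H.gen).1 h1).of_dvd ((dvd_mul_right 2 _).trans H.card)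
    rw [Nat.ModEq] at h2
    omega
  have hg : quadChar F A γ = ((-1 : Aˣ) : A) := by
    rw [quadChar, MulChar.ringHomComp_apply, quadraticChar_neg_one_iff_not_isSquare.2 hns]
    simp
  ext u
  have h1 := zpow_mulChar_apply H.gen hg 1 u.ne_zero
  rw [zpow_one] at h1
  rw [h1, H.apply _ u.ne_zero, zpow_mul, one_mul]
  congr 2
  exact_mod_cast H.pow_sq

lemma jac_cocycle (a b c : ℤ) :
    jacobiSum (X ^ a) (X ^ b) * jacobiSum (X ^ (a + b)) (X ^ c) =
      jacobiSum (X ^ b) (X ^ c) * jacobiSum (X ^ a) (X ^ (b + c)) := by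
  have := jacobiSum_cocycle (a := X ^ a) (b := X ^ b) (c := X ^ c)
    (by rw [← zpow_add]; exact H.sum_eq _) (by rw [← zpow_add]; exact H.sum_eq _)
  rwa [← zpow_add, ← zpow_add] at this

/-- The Jacobi sums of order `l²`. -/
lemma jac_even (k n : ℤ) : jacobiSum (X ^ (2 * k)) (X ^ (2 * k * n)) =
    ∑ v ∈ dom F, ((((y ^ 2) ^ k) ^ expo γ n v : Aˣ) : A) := by
  have h1 := sum_mul_add_one_eq (X ^ (2 * k)) (X ^ (2 * k * n))
  rw [mulChar_zpow_two_mul_neg_one, one_mul] at h1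
  rw [← h1, ← sum_dom (by simp [MulChar.map_nonunit]) (by simp [MulChar.map_nonunit])]
  refine Finset.sum_congr rfl fun v hv => ?_
  rw [mem_dom] at hv
  rw [H.apply _ hv.1, H.apply _ hv.2, ← Units.val_mul, ← zpow_add, ← zpow_natCast y 2, ← zpow_mul,
    ← zpow_mul, expo]
  congr 2
  push_cast; ring

lemma nilp_zpow (k : ℤ) : ((((y ^ 2) ^ k : Aˣ) : A) - 1) ^ (l + 1) = 0 :=
  val_zpow_sub_one_pow_eq_zero H.nilp k

lemma jac_eq_coeffExpr (k n : ℤ) : jacobiSum (X ^ (2 * k)) (X ^ (2 * k * n)) =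
    coeffExpr γ l n (((y ^ 2) ^ k : Aˣ) : A) := by
  rw [H.jac_even, sum_zpow_expo H.prime H.three_le H.gen H.natCast_eq H.isUnit_two H.sq_dvd
    (H.nilp_zpow k)]

lemma jac_eq_neg_one (k n : ℤ) : jacobiSum (X ^ (2 * k)) (X ^ (2 * k * (l * n))) = -1 := by
  rw [H.jac_even, sum_zpow_expo_mul H.prime H.gen H.natCast_eq H.sq_dvd (H.nilp_zpow k),
    ← H.jac_even, mul_zero, zpow_zero, jacobiSum_comm, jacobiSum_one_left (H.sum_eq _)]

lemma two_mul_half : 2 * (((l : ℤ) ^ 2 - 1) / 2) = (l : ℤ) ^ 2 - 1 := by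
  obtain ⟨k, hk⟩ := H.odd
  have : (l : ℤ) ^ 2 - 1 = 2 * (2 * k ^ 2 + 2 * k) := by rw [hk]; push_cast; ring
  omega

/-- The Jacobi sums `J_{2l²}(1,n)` with odd `n`, where `η = X ^ (1 - l²)` and `ψ = X ^ (n - l²)`
have order dividing `l²`. -/
lemma jac_odd {n : ℤ} (hn : Odd n) :
    ∑ v, (X ^ (1 : ℤ)) v * (X ^ n) (v + 1) =
      (((y ^ 2) ^ (-(ind γ (2 : F) : ℤ) * (n + 1)) : Aˣ) : A) *
        coeffExpr γ l (((l : ℤ) ^ 2 - 1) / 2) ((y ^ 2 : Aˣ) : A) *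
        coeffExpr γ l (((l : ℤ) ^ 2 - 1) / 2) (((y ^ 2) ^ n : Aˣ) : A) *
        jacobiSum (X ^ (1 - (l : ℤ) ^ 2)) (X ^ (n - (l : ℤ) ^ 2)) := by
  set m : ℤ := ((l : ℤ) ^ 2 - 1) / 2 with hm
  have hN : (l : ℤ) ^ 2 = 2 * m + 1 := by have := H.two_mul_half; omega
  obtain ⟨r, hr⟩ := hn
  have hper : ∀ {a b : ℤ} (k : ℤ), a - b = 2 * (2 * m + 1) * k → X ^ a = X ^ b := fun k hk =>
    H.X_zpow_congr ⟨k, by rw [hk, hN]⟩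
  have h1 := jacobiSum_quadChar_mul (A := A) H.two_ne_zero_of_card
    (e := X ^ (1 - (l : ℤ) ^ 2)) (f := X ^ (n - (l : ℤ) ^ 2)) (H.sum_eq _) (H.sum_eq _)
    (by rw [← zpow_neg]; exact H.sum_eq _) (by rw [← zpow_neg]; exact H.sum_eq _)
    (by rw [← H.X_zpow_sq]; exact H.sum_eq _) (by rw [← zpow_zero X]; exact H.sum_eq _)
    (by rw [← H.X_zpow_sq, ← zpow_add]; exact H.sum_eq _)
  rw [← H.X_zpow_sq, ← zpow_add, ← zpow_add, add_sub_cancel, add_sub_cancel, ← zpow_neg,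
    ← zpow_neg] at h1
  -- with `l² = 2 m + 1`: the reflection turns `(η⁻¹, η⁻¹)` into `(X ^ (2 m), X ^ 2)`
  have hE : jacobiSum (X ^ (-(1 - (l : ℤ) ^ 2))) (X ^ (-(1 - (l : ℤ) ^ 2))) =
      coeffExpr γ l m ((y ^ 2 : Aˣ) : A) := by
    rw [show -(1 - (l : ℤ) ^ 2) = 2 * m by omega, jacobiSum_zpow_two_mul_refl,
      hper (a := -2 * m - 2 * m) (b := 2 * 1) (-1) (by ring), jacobiSum_comm,
      show 2 * m = 2 * 1 * m by ring, H.jac_eq_coeffExpr, zpow_one]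
  -- likewise `(ψ⁻¹, ψ⁻¹)` becomes `(X ^ (2 n m), X ^ (2 n))`
  have hP : jacobiSum (X ^ (-(n - (l : ℤ) ^ 2))) (X ^ (-(n - (l : ℤ) ^ 2))) =
      coeffExpr γ l m (((y ^ 2) ^ n : Aˣ) : A) := by
    rw [show -(n - (l : ℤ) ^ 2) = 2 * (m - r) by omega, jacobiSum_zpow_two_mul_refl,
      hper (a := -2 * (m - r) - 2 * (m - r)) (b := 2 * n) (-1) (by rw [hr]; ring), jacobiSum_comm,
      hper (a := 2 * (m - r)) (b := 2 * n * m) (-r) (by rw [hr]; ring), H.jac_eq_coeffExpr]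
  have hX4 : ∀ k : ℤ, (X ^ k) 4 = ((y ^ (2 * k * ind γ (2 : F)) : Aˣ) : A) := fun k => by
    rw [show (4 : F) = 2 * 2 by norm_num, map_mul, H.apply k H.two_ne_zero_of_card, ← Units.val_mul,
      ← zpow_add]
    congr 2; ring
  have h4 : (X ^ (-(1 - (l : ℤ) ^ 2))) 4 * (X ^ (-(n - (l : ℤ) ^ 2))) 4 =
      (((y ^ 2) ^ (-(ind γ (2 : F) : ℤ) * (n + 1)) : Aˣ) : A) := by
    rw [hX4, hX4, ← Units.val_mul, ← zpow_add, ← zpow_natCast y 2, ← zpow_mul]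
    congr 1
    refine H.y_zpow_congr ⟨2 * ind γ (2 : F), ?_⟩
    push_cast; ring
  have hs : (X ^ (1 : ℤ)) (-1) * (X ^ ((l : ℤ) ^ 2)) (-1) = 1 := by
    rw [← MulChar.mul_apply, ← zpow_add, show 1 + (l : ℤ) ^ 2 = 2 * (m + 1) by omega,
      mulChar_zpow_two_mul_neg_one]
  rw [sum_mul_add_one_eq, h1, h4, hE, hP]
  linear_combination (((y ^ 2) ^ (-(ind γ (2 : F) : ℤ) * (n + 1)) : Aˣ) : A) *
    (jacobiSum (X ^ (1 - (l : ℤ) ^ 2)) (X ^ (n - (l : ℤ) ^ 2)) *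
      coeffExpr γ l m ((y ^ 2 : Aˣ) : A) * coeffExpr γ l m (((y ^ 2) ^ n : Aˣ) : A)) * hs

/-- The last factor of `jac_odd`: the reflection replaces `ψ` by `(η ψ)⁻¹ = η ^ (-1 - n)`. -/
lemma jac_odd_factor {n : ℤ} (hn : Odd n) :
    jacobiSum (X ^ (1 - (l : ℤ) ^ 2)) (X ^ (n - (l : ℤ) ^ 2)) =
      coeffExpr γ l (-1 - n) (((y ^ 2) ^ ((1 - (l : ℤ) ^ 2) / 2) : Aˣ) : A) := by
  set m : ℤ := ((l : ℤ) ^ 2 - 1) / 2 with hm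
  have hN : (l : ℤ) ^ 2 = 2 * m + 1 := by have := H.two_mul_half; omega
  obtain ⟨r, hr⟩ := hn
  rw [show (1 - (l : ℤ) ^ 2) / 2 = -m by omega, show 1 - (l : ℤ) ^ 2 = 2 * -m by omega,
    jacobiSum_zpow_two_mul_refl, ← H.jac_eq_coeffExpr]
  congr 1
  exact H.X_zpow_congr ⟨-r, by rw [hN, hr]; ring_nf⟩

/-- The last factor of `jac_odd` for `n = d l`, expanded at `W = (η ψ)⁻¹` instead of `η`. That
`W ^ (d l - 1) = η` holds because `l² (1 - d²)` is divisible by `2 l²`. -/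
lemma jac_odd_factor_of_dvd {d : ℤ} (hd : Odd d) :
    jacobiSum (X ^ (1 - (l : ℤ) ^ 2)) (X ^ (d * l - (l : ℤ) ^ 2)) =
      coeffExpr γ l (d * l - 1) (((y ^ 2) ^ ((-1 - d * (l : ℤ)) / 2) : Aˣ) : A) := by
  set m : ℤ := ((l : ℤ) ^ 2 - 1) / 2 with hm
  have hN : (l : ℤ) ^ 2 = 2 * m + 1 := by have := H.two_mul_half; omega
  obtain ⟨r, hr⟩ := hd.mul (show Odd (l : ℤ) by exact_mod_cast H.odd)
  obtain ⟨s, hs⟩ := hd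
  rw [show (-1 - d * (l : ℤ)) / 2 = -(r + 1) by omega, show 1 - (l : ℤ) ^ 2 = 2 * -m by omega,
    jacobiSum_zpow_two_mul_refl, ← H.jac_eq_coeffExpr, jacobiSum_comm]
  congr 1
  · exact H.X_zpow_congr ⟨1, by rw [hN, hr]; ring⟩
  · refine H.X_zpow_congr ⟨2 * s ^ 2 + 2 * s, ?_⟩
    have h1 : (2 * r + 1) ^ 2 = d ^ 2 * (l : ℤ) ^ 2 := by rw [← hr]; ring
    rw [hr]
    have h2 : (2 * r + 1 : ℤ) ^ 2 = (2 * s + 1) ^ 2 * (l : ℤ) ^ 2 := by rw [h1, hs]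
    linear_combination h2 + hN

/-- The terms with `i ≥ 3` vanish, since `z ^ (d * l) - 1` is a multiple of `(z - 1) ^ l`. -/
lemma coeffExpr_zpow_mul (n d : ℤ) : coeffExpr γ l n (((y ^ 2) ^ (d * l) : Aˣ) : A) = -1 := by
  apply coeffExpr_eq_neg_one
  rw [mul_comm, zpow_mul, zpow_natCast,
    val_zpow_of_mul_self_eq_zero (sub_one_pow_mul_self H.prime.pos H.nilp)
      (val_pow_prime H.prime H.natCast_eq _)]
  have := sub_one_pow_mul_self H.prime.pos H.nilp
  linear_combination (d : A) ^ 3 * (((y ^ 2 : Aˣ) : A) - 1) ^ l * this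

lemma isUnit_coeffExpr (n k : ℤ) : IsUnit (coeffExpr γ l n (((y ^ 2) ^ k : Aˣ) : A)) := by
  refine (IsNilpotent.isUnit_add_left_of_commute ?_ isUnit_one.neg (Commute.all _ _))
  refine isNilpotent_sum fun i hi => ?_
  have hi0 : i ≠ 0 := by have := (Finset.mem_Icc.1 hi).1; omega
  refine Commute.isNilpotent_mul_left (Commute.all _ _) ?_
  exact IsNilpotent.pow_of_pos ⟨l + 1, H.nilp_zpow k⟩ hi0

/-- For odd `n` all factors in `jac_odd` are units, and the reflection takes even `n` to odd `n`. -/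
lemma isUnit_jac_one (n : ℤ) : IsUnit (∑ v, (X ^ (1 : ℤ)) v * (X ^ n) (v + 1)) := by
  have hodd : ∀ {n : ℤ}, Odd n → IsUnit (∑ v, (X ^ (1 : ℤ)) v * (X ^ n) (v + 1)) := by
    intro n hn
    rw [H.jac_odd hn, H.jac_odd_factor hn]
    have h1 := H.isUnit_coeffExpr (((l : ℤ) ^ 2 - 1) / 2) 1
    rw [zpow_one] at h1
    exact (((Units.isUnit _).mul h1).mul (H.isUnit_coeffExpr _ _)).mul (H.isUnit_coeffExpr _ _)
  rcases Int.even_or_odd n with hn | hn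
  · rw [sum_mul_add_one_refl]
    refine IsUnit.mul (IsUnit.of_mul_eq_one _ (mulChar_neg_one_mul_self (X ^ (1 : ℤ)))) (hodd ?_)
    obtain ⟨r, hr⟩ := hn
    exact ⟨-r - 1, by omega⟩
  · exact hodd hn

/-- The relation which determines all Jacobi sums by the `J(1,t)`, from the cocycle relation. -/
lemma jac_mul_prod (i j : ℕ) :
    (∑ v, (X ^ (i : ℤ)) v * (X ^ ((j + 1 : ℕ) : ℤ)) (v + 1)) *
        ∏ t ∈ Finset.Ico 1 (j + 1), ∑ v, (X ^ (1 : ℤ)) v * (X ^ (t : ℤ)) (v + 1) =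
      (X ^ (1 : ℤ)) (-1) ^ (i + 1) *
        ∏ t ∈ Finset.Ico i (i + (j + 1)), ∑ v, (X ^ (1 : ℤ)) v * (X ^ (t : ℤ)) (v + 1) := by
  have hsgn : (X ^ (i : ℤ)) (-1) = (X ^ (1 : ℤ)) (-1) ^ i := by
    have := MulChar.pow_apply_coe X i (-1)
    rw [Units.val_neg, Units.val_one] at this
    rw [zpow_natCast, this, zpow_one]
  induction j with
  | zero =>
    simp only [sum_mul_add_one_eq, hsgn]
    rw [Finset.Ico_self, Finset.prod_empty, zero_add, Nat.Ico_succ_singleton,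
      Finset.prod_singleton, jacobiSum_comm, Nat.cast_one]
    linear_combination (-(X ^ (1 : ℤ)) (-1) ^ i * jacobiSum (X ^ (1 : ℤ)) (X ^ (i : ℤ))) *
      mulChar_neg_one_mul_self (X ^ (1 : ℤ))
  | succ j ih =>
    rw [Finset.prod_Ico_succ_top (Nat.le_add_left 1 j), ← add_assoc i (j + 1) 1,
      Finset.prod_Ico_succ_top (Nat.le_add_right i (j + 1)),
      ← mul_assoc ((X ^ (1 : ℤ)) (-1) ^ (i + 1)), ← ih]
    have h1 := H.jac_cocycle i ((j + 1 : ℕ) : ℤ) 1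
    simp only [sum_mul_add_one_eq]
    rw [show ((j + 1 + 1 : ℕ) : ℤ) = ((j + 1 : ℕ) : ℤ) + 1 by push_cast; ring,
      show ((i + (j + 1) : ℕ) : ℤ) = i + ((j + 1 : ℕ) : ℤ) by push_cast; ring,
      jacobiSum_comm (X ^ (1 : ℤ)) (X ^ ((j + 1 : ℕ) : ℤ)),
      jacobiSum_comm (X ^ (1 : ℤ)) (X ^ ((i : ℤ) + ((j + 1 : ℕ) : ℤ)))]
    generalize ∏ t ∈ Finset.Ico 1 (j + 1),
      (X ^ (1 : ℤ)) (-1) * jacobiSum (X ^ (1 : ℤ)) (X ^ (t : ℤ)) = P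
    linear_combination (-(X ^ (i : ℤ)) (-1) * (X ^ (1 : ℤ)) (-1) * P) * h1

end JacobiSetting
end Setting

/-! ### The ring `ℤ[ζ_{2l²}]` -/

section Ring

lemma zeta_isPrimitiveRoot {e : ℕ} (he : e ≠ 0) : IsPrimitiveRoot (zeta e) e :=
  Complex.isPrimitiveRoot_exp e he

lemma zeta_two_mul_sq (e : ℕ) : zeta (2 * e) ^ 2 = zeta e := by
  rw [zeta, zeta, ← Complex.exp_nat_mul]
  congr 1
  rcases eq_or_ne (e : ℂ) 0 with h | h
  · push_cast; rw [h]; simp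
  · push_cast; field_simp

lemma zeta_two_mul_pow {e : ℕ} (he : e ≠ 0) : zeta (2 * e) ^ e = -1 := by
  rw [zeta, ← Complex.exp_nat_mul, ← Complex.exp_pi_mul_I]
  congr 1
  have : (e : ℂ) ≠ 0 := by exact_mod_cast he
  push_cast; field_simp

lemma zeta_mem_ringZ (l : ℕ) : zeta (2 * l ^ 2) ∈ ringZ l :=
  Algebra.subset_adjoin (Set.mem_singleton _)

/-- `ζ_{2l²}` as a unit of `ℤ[ζ_{2l²}]`. -/
noncomputable def zetaUnit {l : ℕ} (hl : l ≠ 0) : (ringZ l)ˣ :=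
  Units.ofPowEqOne ⟨zeta (2 * l ^ 2), zeta_mem_ringZ l⟩ (2 * l ^ 2)
    (Subtype.ext (zeta_isPrimitiveRoot (by positivity)).pow_eq_one) (by positivity)

lemma coe_zetaUnit_zpow {l : ℕ} (hl : l ≠ 0) (n : ℤ) :
    (((zetaUnit hl ^ n : (ringZ l)ˣ) : ringZ l) : ℂ) = zeta (2 * l ^ 2) ^ n := by
  have h : Units.map ((ringZ l).val : ringZ l →* ℂ) (zetaUnit hl ^ n) =
      Units.map ((ringZ l).val : ringZ l →* ℂ) (zetaUnit hl) ^ n := map_zpow _ _ _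
  have h2 := congrArg Units.val h
  rw [Units.val_zpow_eq_zpow_val] at h2
  exact h2

lemma coe_zetaUnit_sq_zpow {l : ℕ} (hl : l ≠ 0) (n : ℤ) :
    ((((zetaUnit hl ^ 2) ^ n : (ringZ l)ˣ) : ringZ l) : ℂ) = zeta (l ^ 2) ^ n := by
  rw [← zpow_natCast, ← zpow_mul, coe_zetaUnit_zpow, zpow_mul, zpow_natCast, zeta_two_mul_sq]

lemma zetaUnit_pow {l : ℕ} (hl : l ≠ 0) : zetaUnit hl ^ l ^ 2 = -1 := by
  ext
  have h := coe_zetaUnit_zpow hl ((l ^ 2 : ℕ) : ℤ)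
  rw [zpow_natCast, zpow_natCast, zeta_two_mul_pow (by positivity)] at h
  rw [h]; simp

/-- The prime `l` is divisible by `(1 - ζ_{l²}) ^ (l + 1)`: it is the product of the `l (l - 1)`
numbers `1 - μ`, for `μ` a primitive `l²`-th root of unity, and `1 - ζ_{l²}` divides each. -/
lemma exists_natCast_eq_mul {l : ℕ} (hl : l.Prime) (hl3 : 3 ≤ l) :
    ∃ r : ringZ l, (l : ringZ l) =
      (1 - ((zetaUnit hl.ne_zero ^ 2 : (ringZ l)ˣ) : ringZ l)) ^ (l + 1) * r := by
  have := Fact.mk hl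
  set z : ringZ l := ((zetaUnit hl.ne_zero ^ 2 : (ringZ l)ˣ) : ringZ l) with hzdef
  have hz : (z : ℂ) = zeta (l ^ 2) := by
    have := coe_zetaUnit_sq_zpow hl.ne_zero 1
    rwa [zpow_one, zpow_one] at this
  have hprim : IsPrimitiveRoot (zeta (l ^ 2)) (l ^ 2) :=
    zeta_isPrimitiveRoot (pow_ne_zero 2 hl.ne_zero)
  have hfac : ∀ μ : ℂ, ∃ r : ringZ l, μ ∈ primitiveRoots (l ^ 2) ℂ → 1 - μ = (1 - z : ℂ) * r := by
    intro μ
    by_cases hμ : μ ∈ primitiveRoots (l ^ 2) ℂ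
    · have h1 := (isPrimitiveRoot_of_mem_primitiveRoots hμ).pow_eq_one
      obtain ⟨k, _, rfl⟩ := hprim.eq_pow_of_pow_eq_one h1
      obtain ⟨r, hr⟩ := one_sub_dvd_one_sub_pow z k
      refine ⟨r, fun _ => ?_⟩
      have := congrArg (Subtype.val) hr
      rw [← hz]
      exact_mod_cast this
    · exact ⟨0, fun h => absurd h hμ⟩
  choose r hr using hfac
  have h1 : (l : ℂ) = ∏ μ ∈ primitiveRoots (l ^ 2) ℂ, (1 - μ) := by
    have h2 := Polynomial.eval_one_cyclotomic_prime_pow (R := ℂ) (p := l) 1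
    rw [← h2, Polynomial.cyclotomic_eq_prod_X_sub_primitiveRoots hprim, Polynomial.eval_prod]
    simp
  have h2 : (l : ringZ l) = (1 - z) ^ (l * (l - 1)) * ∏ μ ∈ primitiveRoots (l ^ 2) ℂ, r μ := by
    apply Subtype.ext
    push_cast
    rw [h1, Finset.prod_congr rfl fun μ hμ => hr μ hμ, Finset.prod_mul_distrib,
      Finset.prod_const, hprim.card_primitiveRoots, Nat.totient_prime_pow hl two_pos,
      show 2 - 1 = 1 from rfl, pow_one]
  have h3 : l + 1 ≤ l * (l - 1) := by
    obtain ⟨k, rfl⟩ := Nat.exists_eq_add_of_le hl3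
    rw [show 3 + k - 1 = k + 2 by omega]; nlinarith
  refine ⟨(1 - z) ^ (l * (l - 1) - (l + 1)) * ∏ μ ∈ primitiveRoots (l ^ 2) ℂ, r μ, ?_⟩
  rw [← mul_assoc, ← pow_add, Nat.add_sub_cancel' h3]
  exact h2

/-- The quotient of `R` by the principal ideal of `a`. The existential form hides its construction,
so that `a` does not occur in the types of terms over the quotient. -/
lemma exists_residue_map.{u} {R : Type u} [CommRing R] (a : R) :
    ∃ (A : Type u) (_ : CommRing A) (π : R →+* A),
      Function.Surjective π ∧ ∀ b, π b = 0 ↔ a ∣ b :=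
  ⟨R ⧸ Ideal.span {a}, inferInstance, Ideal.Quotient.mk _, Ideal.Quotient.mk_surjective, fun _ => by
    rw [Ideal.Quotient.eq_zero_iff_mem, Ideal.mem_span_singleton]⟩

lemma cong_of_dvd {l : ℕ} (hl : l ≠ 0) {a b : ringZ l}
    (h : (1 - ((zetaUnit hl ^ 2 : (ringZ l)ˣ) : ringZ l)) ^ (l + 1) ∣ a - b) : Cong l a b := by
  obtain ⟨r, hr⟩ := h
  refine ⟨r, r.2, ?_⟩
  have h1 := congrArg Subtype.val hr
  have h2 := coe_zetaUnit_sq_zpow hl 1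
  rw [zpow_one, zpow_one] at h2
  rw [← h2]
  exact_mod_cast h1

end Ring

/-! ### Jacobi sums in `ℤ[ζ_{2l²}]` -/

section Transfer
variable {F : Type*} [Field F] [Fintype F] {γ : Fˣ} {l : ℕ}

lemma map_coeffExpr {A B : Type*} [CommRing A] [CommRing B] (f : A →+* B) (n : ℤ) (x : A) :
    f (coeffExpr γ l n x) = coeffExpr γ l n (f x) := by
  simp [coeffExpr]

lemma coe_coeffExpr (hl : l ≠ 0) (n k : ℤ) :
    ((coeffExpr γ l n (((zetaUnit hl ^ 2) ^ k : (ringZ l)ˣ) : ringZ l) : ringZ l) : ℂ) =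
      cExpr γ l n (zeta (l ^ 2) ^ k) := by
  have h := map_coeffExpr (γ := γ) (l := l) (ringZ l).val.toRingHom n
    (((zetaUnit hl ^ 2) ^ k : (ringZ l)ˣ) : ringZ l)
  rw [← coe_zetaUnit_sq_zpow hl]
  exact h

lemma exists_mulChar {A : Type*} [CommRing A] (hγ : ∀ x : Fˣ, x ∈ Subgroup.zpowers γ) {y : Aˣ}
    (hy : y ^ (Fintype.card F - 1) = 1) : ∃ X : MulChar F A, X γ = y := by
  refine ⟨MulChar.ofUnitHom (monoidHomOfForallMemZpowers hγ (g' := y) ?_), ?_⟩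
  · rw [orderOf_generator hγ]
    exact orderOf_dvd_of_pow_eq_one hy
  · rw [MulChar.ofUnitHom_coe, monoidHomOfForallMemZpowers_apply_gen]

lemma map_sum_zpow_mul_zpow {R A : Type*} [CommRing R] [CommRing A] (π : R →+* A)
    (X : MulChar F R) (i j : ℤ) :
    π (∑ v, (X ^ i) v * (X ^ j) (v + 1)) =
      ∑ v, ((X.ringHomComp π) ^ i) v * ((X.ringHomComp π) ^ j) (v + 1) := by
  rw [map_sum]
  refine Finset.sum_congr rfl fun v _ => ?_
  rw [map_mul, MulChar.ringHomComp_zpow, MulChar.ringHomComp_zpow, MulChar.ringHomComp_apply,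
    MulChar.ringHomComp_apply]

lemma jacobiSetting {A : Type*} [CommRing A] (hl : l.Prime) (hl3 : 3 ≤ l)
    (hγ : ∀ x : Fˣ, x ∈ Subgroup.zpowers γ) (hq : 2 * l ^ 2 ∣ Fintype.card F - 1)
    {X : MulChar F (ringZ l)} (hX : X γ = ((zetaUnit hl.ne_zero : (ringZ l)ˣ) : ringZ l))
    {π : ringZ l →+* A}
    (hπ : ∀ b, π b = 0 ↔
      (1 - ((zetaUnit hl.ne_zero ^ 2 : (ringZ l)ˣ) : ringZ l)) ^ (l + 1) ∣ b) :
    JacobiSetting γ l (X.ringHomComp π) (Units.map (π : ringZ l →* A) (zetaUnit hl.ne_zero)) := by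
  have hl0 : π (l : ringZ l) = 0 := (hπ _).2 (exists_natCast_eq_mul hl hl3)
  refine ⟨hl, hl3, hq, hγ, by rw [← hl0, map_natCast], ?_, ?_, ?_, ?_⟩
  · rw [MulChar.ringHomComp_apply, hX]; rfl
  · rw [← map_pow, zetaUnit_pow]; ext; simp
  · have h : π ((((zetaUnit hl.ne_zero ^ 2 : (ringZ l)ˣ) : ringZ l) - 1) ^ (l + 1)) = 0 :=
      (hπ _).2 (pow_dvd_pow_of_dvd ⟨-1, by ring⟩ _)
    rw [map_pow, map_sub, map_one] at h
    rw [← map_pow]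
    exact h
  · intro n
    classical
    rw [MulChar.ringHomComp_zpow]
    change ∑ v, π ((X ^ n) v) = 0
    rw [← map_sum]
    by_cases h : X ^ n = 1
    · obtain ⟨k, hk⟩ := hq
      rw [h, MulChar.sum_one_eq_card_units, Fintype.card_units, hk]
      push_cast
      rw [map_mul, map_mul, map_pow, hl0]
      ring
    · rw [MulChar.sum_eq_zero_of_ne_one h, map_zero]

variable (hl : l ≠ 0) (hγ : ∀ x : Fˣ, x ∈ Subgroup.zpowers γ) {X : MulChar F (ringZ l)}
  (hX : X γ = ((zetaUnit hl : (ringZ l)ˣ) : ringZ l))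
include hγ hX

lemma chi_eq (i : ℤ) (v : F) : chi γ (2 * l ^ 2) i v = (((X ^ i) v : ringZ l) : ℂ) := by
  rcases eq_or_ne v 0 with rfl | hv
  · simp [chi, MulChar.map_nonunit]
  · rw [chi, if_neg hv, zpow_mulChar_apply hγ hX i hv, coe_zetaUnit_zpow]

lemma chi_sq_eq (i : ℤ) (v : F) : chi γ (l ^ 2) i v = (((X ^ (2 * i)) v : ringZ l) : ℂ) := by
  rcases eq_or_ne v 0 with rfl | hv
  · simp [chi, MulChar.map_nonunit]
  · rw [chi, if_neg hv, zpow_mulChar_apply hγ hX _ hv, mul_assoc, coe_zetaUnit_zpow,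
      zpow_mul _ 2, zpow_ofNat, zeta_two_mul_sq]

lemma J_eq (i j : ℤ) :
    J γ (2 * l ^ 2) i j = ((∑ v, (X ^ i) v * (X ^ j) (v + 1) : ringZ l) : ℂ) := by
  simp only [J, chi_eq hl hγ hX]
  push_cast; rfl

lemma J_sq_eq (i j : ℤ) :
    J γ (l ^ 2) i j = ((∑ v, (X ^ (2 * i)) v * (X ^ (2 * j)) (v + 1) : ringZ l) : ℂ) := by
  simp only [J, chi_sq_eq hl hγ hX]
  push_cast; rfl

end Transfer
end JacobiCong

/-! ### Congruences for the Jacobi sums of order `2l²` -/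

theorem mainTheorem2 {F : Type*} [Field F] [Fintype F] (l : ℕ) (hl : l.Prime) (hl3 : 3 ≤ l)
    (hq : Fintype.card F ≡ 1 [MOD 2 * l ^ 2])
    (γ : Fˣ) (hγ : ∀ x : Fˣ, x ∈ Subgroup.zpowers γ)
    (w : ℤ) (hw : w = (JacobiCong.ind γ (2 : F) : ℤ)) :
    -- the coefficients `c_{i,n}` are those of the congruence for `J_{l²}(1,n)`
    (∀ n : ℤ, 1 ≤ n → n ≤ l ^ 2 - 1 →
      (Int.gcd l n = 1 → JacobiCong.Cong l (JacobiCong.J γ (l ^ 2) 1 n)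
        (JacobiCong.cExpr γ l n (JacobiCong.zeta (l ^ 2)))) ∧
      (Int.gcd l n = l → JacobiCong.Cong l (JacobiCong.J γ (l ^ 2) 1 n) (-1))) ∧
    -- `n = l²`
    JacobiCong.Cong l (JacobiCong.J γ (2 * l ^ 2) 1 (l ^ 2))
      (JacobiCong.zeta (l ^ 2) ^ (-w) *
        JacobiCong.cExpr γ l (((l : ℤ) ^ 2 - 1) / 2) (JacobiCong.zeta (l ^ 2))) ∧
    -- `n = dl` with `d ≠ l` odd
    (∀ d : ℤ, 1 ≤ d → d ≤ 2 * l - 1 → Odd d → d ≠ l →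
      JacobiCong.Cong l (JacobiCong.J γ (2 * l ^ 2) 1 (d * l))
        (-JacobiCong.zeta (l ^ 2) ^ (-w * (d * l + 1)) *
          JacobiCong.cExpr γ l (((l : ℤ) ^ 2 - 1) / 2) (JacobiCong.zeta (l ^ 2)) *
          JacobiCong.cExpr γ l (d * l - 1)
            (JacobiCong.zeta (l ^ 2) ^ ((-1 - d * (l : ℤ)) / 2)))) ∧
    -- `gcd(n, 2l²) = 1`, `n < 2l² - 1`
    (∀ n : ℤ, 1 ≤ n → n < 2 * l ^ 2 - 1 → Int.gcd n (2 * l ^ 2) = 1 →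
      JacobiCong.Cong l (JacobiCong.J γ (2 * l ^ 2) 1 n)
        (JacobiCong.zeta (l ^ 2) ^ (-w * (n + 1)) *
          JacobiCong.cExpr γ l (((l : ℤ) ^ 2 - 1) / 2) (JacobiCong.zeta (l ^ 2)) *
          JacobiCong.cExpr γ l (((l : ℤ) ^ 2 - 1) / 2) (JacobiCong.zeta (l ^ 2) ^ n) *
          JacobiCong.cExpr γ l (-1 - n)
            (JacobiCong.zeta (l ^ 2) ^ ((1 - (l : ℤ) ^ 2) / 2)))) ∧
    -- `n = 2l² - 1`
    JacobiCong.Cong l (JacobiCong.J γ (2 * l ^ 2) 1 (2 * l ^ 2 - 1)) (-1) ∧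
    -- these cases exhaust the odd `n`
    (∀ n : ℤ, 1 ≤ n → n ≤ 2 * l ^ 2 - 1 → Odd n →
      n = l ^ 2 ∨ (∃ d : ℤ, 1 ≤ d ∧ d ≤ 2 * l - 1 ∧ Odd d ∧ d ≠ l ∧ n = d * l) ∨
      (n < 2 * l ^ 2 - 1 ∧ Int.gcd n (2 * l ^ 2) = 1) ∨ n = 2 * l ^ 2 - 1) ∧
    -- even `n`
    (∀ n : ℤ, 2 ≤ n → n ≤ 2 * l ^ 2 - 2 → Even n →
      JacobiCong.J γ (2 * l ^ 2) 1 n =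
        JacobiCong.chi γ (2 * l ^ 2) 1 (-1) *
          JacobiCong.J γ (2 * l ^ 2) 1 (2 * l ^ 2 - n - 1)) ∧
    -- even `d`
    (∀ d : ℤ, 1 ≤ d → d ≤ 2 * l - 1 → Even d →
      Odd (2 * (l : ℤ) ^ 2 - d * l - 1) ∧
      JacobiCong.J γ (2 * l ^ 2) 1 (d * l) =
        JacobiCong.chi γ (2 * l ^ 2) 1 (-1) *
          JacobiCong.J γ (2 * l ^ 2) 1 (2 * l ^ 2 - d * l - 1)) ∧
    -- the sums `J_{2l²}(1,n)` are units modulo `(1 - ζ_{l²})^{l+1}`, and they determine all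
    -- Jacobi sums of order `2l²` modulo `(1 - ζ_{l²})^{l+1}`
    (∀ n : ℤ, ∃ u ∈ JacobiCong.ringZ l,
      JacobiCong.Cong l (JacobiCong.J γ (2 * l ^ 2) 1 n * u) 1) ∧
    (∀ i j : ℕ, 1 ≤ j →
      JacobiCong.Cong l
        (JacobiCong.J γ (2 * l ^ 2) i j *
          ∏ t ∈ Finset.Ico 1 j, JacobiCong.J γ (2 * l ^ 2) 1 t)
        (JacobiCong.chi γ (2 * l ^ 2) 1 (-1) ^ (i + 1) *
          ∏ t ∈ Finset.Ico i (i + j), JacobiCong.J γ (2 * l ^ 2) 1 t)) := by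
  have hl0 := hl.ne_zero
  have hcard : 2 * l ^ 2 ∣ Fintype.card F - 1 :=
    (Nat.modEq_iff_dvd' Fintype.card_pos).1 hq.symm
  have hy2 : JacobiCong.zetaUnit hl0 ^ (2 * l ^ 2) = 1 := by
    rw [mul_comm, pow_mul, JacobiCong.zetaUnit_pow]; simp
  obtain ⟨X, hX⟩ := JacobiCong.exists_mulChar hγ (y := JacobiCong.zetaUnit hl0) (by
    obtain ⟨k, hk⟩ := hcard
    rw [hk, pow_mul, hy2, one_pow])
  have hXN : X ^ (2 * (l : ℤ) ^ 2) = X ^ (0 : ℤ) :=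
    JacobiCong.mulChar_zpow_congr hγ hX (N := 2 * (l : ℤ) ^ 2) (by exact_mod_cast hy2) (by simp)
  obtain ⟨A, _, π, hsurj, hπ⟩ := JacobiCong.exists_residue_map
    ((1 - ((JacobiCong.zetaUnit hl0 ^ 2 : (JacobiCong.ringZ l)ˣ) : JacobiCong.ringZ l)) ^ (l + 1))
  -- `A` is `ℤ[ζ_{2l²}]` modulo `(1 - ζ_{l²}) ^ (l + 1)`: a congruence is an equality in `A`
  have H := JacobiCong.jacobiSetting hl hl3 hγ hcard hX hπ
  have hcong : ∀ {a b : JacobiCong.ringZ l}, π a = π b → JacobiCong.Cong l a b := fun h =>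
    JacobiCong.cong_of_dvd hl0 ((hπ _).1 (by rw [map_sub, h, sub_self]))
  have hJ := JacobiCong.J_eq hl0 hγ hX
  have hJ2 := JacobiCong.J_sq_eq hl0 hγ hX
  have hchi := JacobiCong.chi_eq hl0 hγ hX
  have hT := JacobiCong.map_sum_zpow_mul_zpow π X
  have hz := JacobiCong.coe_zetaUnit_sq_zpow hl0
  have hc := JacobiCong.coe_coeffExpr (γ := γ) hl0
  generalize JacobiCong.zetaUnit hl0 = y at *
  have hodd : Odd (l : ℤ) := by exact_mod_cast H.odd
  -- `ζ_{l²}` as a first power, the form to which `hz` and `hc` apply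
  have hz1 : JacobiCong.zeta (l ^ 2) = JacobiCong.zeta (l ^ 2) ^ (1 : ℤ) := (zpow_one _).symm
  have hneg : ((-1 : JacobiCong.ringZ l) : ℂ) = -1 := by simp
  have hπz : ∀ k : ℤ, π (((y ^ 2) ^ k : (JacobiCong.ringZ l)ˣ) : JacobiCong.ringZ l) =
      ((((Units.map (π : JacobiCong.ringZ l →* A) y) ^ 2) ^ k : Aˣ) : A) := fun k => by
    rw [← map_pow, ← map_zpow]; rfl
  have hπc : ∀ n k : ℤ, π (JacobiCong.coeffExpr γ l n
      (((y ^ 2) ^ k : (JacobiCong.ringZ l)ˣ) : JacobiCong.ringZ l)) =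
      JacobiCong.coeffExpr γ l n
        ((((Units.map (π : JacobiCong.ringZ l →* A) y) ^ 2) ^ k : Aˣ) : A) := fun n k => by
    rw [JacobiCong.map_coeffExpr, hπz]
  subst hw
  have hrefl : ∀ n : ℤ, JacobiCong.J γ (2 * l ^ 2) 1 n =
      JacobiCong.chi γ (2 * l ^ 2) 1 (-1) *
        JacobiCong.J γ (2 * l ^ 2) 1 (2 * l ^ 2 - n - 1) := fun n => by
    rw [hJ, hJ, hchi, ← Subalgebra.coe_mul, JacobiCong.sum_mul_add_one_refl X n,
      show 2 * (l : ℤ) ^ 2 - n - 1 = 2 * (l : ℤ) ^ 2 + (-1 - n) by ring, zpow_add X _ (-1 - n),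
      hXN, zpow_zero, one_mul]
  refine ⟨?_, ?_, ?_, ?_, ?_, ?_, ?_, ?_, ?_, ?_⟩
  · intro n _ _
    refine ⟨fun _ => ?_, fun hn => ?_⟩
    · rw [hz1, ← hc, hJ2]
      apply hcong
      rw [hT, hπc, JacobiCong.sum_mul_add_one_eq, JacobiCong.mulChar_zpow_two_mul_neg_one,
        one_mul, show 2 * n = 2 * 1 * n by ring, H.jac_eq_coeffExpr]
    · obtain ⟨k, rfl⟩ : (l : ℤ) ∣ n := by
        have := Int.gcd_dvd_right (l : ℤ) n
        rwa [hn] at this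
      rw [hJ2, ← hneg]
      apply hcong
      rw [hT, JacobiCong.sum_mul_add_one_eq, JacobiCong.mulChar_zpow_two_mul_neg_one,
        one_mul, show 2 * ((l : ℤ) * k) = 2 * 1 * (l * k) by ring, H.jac_eq_neg_one, map_neg,
        map_one]
  · have h1 := hcong (a := ∑ v, (X ^ (1 : ℤ)) v * (X ^ ((l : ℤ) ^ 2)) (v + 1))
      (b := (((y ^ 2) ^ (-(JacobiCong.ind γ (2 : F) : ℤ)) :
          (JacobiCong.ringZ l)ˣ) : JacobiCong.ringZ l) *
        JacobiCong.coeffExpr γ l (((l : ℤ) ^ 2 - 1) / 2)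
          (((y ^ 2) ^ (1 : ℤ) : (JacobiCong.ringZ l)ˣ) : JacobiCong.ringZ l)) (by
        -- `ζ_{l²} ^ l² = 1`
        have hU : ((Units.map (π : JacobiCong.ringZ l →* A) y) ^ 2) ^
            (-(JacobiCong.ind γ (2 : F) : ℤ) * ((l : ℤ) ^ 2 + 1)) =
            ((Units.map (π : JacobiCong.ringZ l →* A) y) ^ 2) ^
              (-(JacobiCong.ind γ (2 : F) : ℤ)) := by
          rw [← zpow_natCast _ 2, ← zpow_mul, ← zpow_mul]
          exact H.y_zpow_congr ⟨-(JacobiCong.ind γ (2 : F) : ℤ), by push_cast; ring⟩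
        rw [hT, H.jac_odd hodd.pow, hU, sub_self, zpow_zero, jacobiSum_comm,
          JacobiCong.jacobiSum_one_left (H.sum_eq _), pow_two (l : ℤ), H.coeffExpr_zpow_mul,
          ← pow_two, map_mul, hπz, hπc, zpow_one (_ ^ 2)]
        ring)
    rw [← hJ] at h1
    simp only [Subalgebra.coe_mul] at h1
    rwa [hz, hc, zpow_one] at h1
  · intro d _ _ hd _
    have h1 := hcong (a := ∑ v, (X ^ (1 : ℤ)) v * (X ^ (d * l)) (v + 1))
      (b := -(((y ^ 2) ^ (-(JacobiCong.ind γ (2 : F) : ℤ) * (d * l + 1)) :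
          (JacobiCong.ringZ l)ˣ) : JacobiCong.ringZ l) *
        JacobiCong.coeffExpr γ l (((l : ℤ) ^ 2 - 1) / 2)
          (((y ^ 2) ^ (1 : ℤ) : (JacobiCong.ringZ l)ˣ) : JacobiCong.ringZ l) *
        JacobiCong.coeffExpr γ l (d * l - 1)
          (((y ^ 2) ^ ((-1 - d * (l : ℤ)) / 2) : (JacobiCong.ringZ l)ˣ) : JacobiCong.ringZ l))
      (by
        rw [hT, H.jac_odd (hd.mul hodd), H.jac_odd_factor_of_dvd hd, H.coeffExpr_zpow_mul,
          map_mul, map_mul, map_neg, hπz, hπc, hπc, zpow_one (_ ^ 2)]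
        ring)
    rw [← hJ] at h1
    simp only [Subalgebra.coe_mul, Subalgebra.coe_neg] at h1
    rwa [hz, hc, hc, zpow_one] at h1
  · intro n _ _ hn
    have hn : Odd n := by
      rw [← Int.not_even_iff_odd]
      intro h
      have h2 := Int.dvd_gcd (even_iff_two_dvd.1 h) (dvd_mul_right (2 : ℤ) ((l : ℤ) ^ 2))
      rw [hn] at h2
      norm_num at h2
    have h1 := hcong (a := ∑ v, (X ^ (1 : ℤ)) v * (X ^ n) (v + 1))
      (b := (((y ^ 2) ^ (-(JacobiCong.ind γ (2 : F) : ℤ) * (n + 1)) :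
          (JacobiCong.ringZ l)ˣ) : JacobiCong.ringZ l) *
        JacobiCong.coeffExpr γ l (((l : ℤ) ^ 2 - 1) / 2)
          (((y ^ 2) ^ (1 : ℤ) : (JacobiCong.ringZ l)ˣ) : JacobiCong.ringZ l) *
        JacobiCong.coeffExpr γ l (((l : ℤ) ^ 2 - 1) / 2)
          (((y ^ 2) ^ n : (JacobiCong.ringZ l)ˣ) : JacobiCong.ringZ l) *
        JacobiCong.coeffExpr γ l (-1 - n)
          (((y ^ 2) ^ ((1 - (l : ℤ) ^ 2) / 2) : (JacobiCong.ringZ l)ˣ) : JacobiCong.ringZ l))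
      (by
        rw [hT, H.jac_odd hn, H.jac_odd_factor hn, map_mul, map_mul, map_mul, hπz, hπc, hπc, hπc,
          zpow_one (_ ^ 2)])
    rw [← hJ] at h1
    simp only [Subalgebra.coe_mul] at h1
    rwa [hz, hc, hc, hc, zpow_one] at h1
  · rw [hJ, ← hneg]
    apply hcong
    rw [hT, JacobiCong.sum_mul_add_one_eq, H.X_zpow_congr (a := 2 * (l : ℤ) ^ 2 - 1) (b := -1)
      ⟨1, by ring⟩, zpow_neg, JacobiCong.jacobiSum_inv_right (H.sum_eq _), mul_neg,
      JacobiCong.mulChar_neg_one_mul_self, map_neg, map_one]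
  · intro n h1 h2 hn
    by_cases hln : (l : ℤ) ∣ n
    · obtain ⟨d, rfl⟩ := hln
      by_cases hdl : d = l
      · left; rw [hdl, pow_two]
      · right; left
        have hl' : (0 : ℤ) < l := by omega
        refine ⟨d, by nlinarith, by nlinarith, (Int.odd_mul.1 hn).2, hdl, mul_comm _ _⟩
    · right; right
      rcases eq_or_ne n (2 * l ^ 2 - 1) with h | h
      · right; exact h
      · left
        refine ⟨by omega, ?_⟩
        rw [← Int.isCoprime_iff_gcd_eq_one]
        refine IsCoprime.mul_right ?_ (IsCoprime.pow_right ?_)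
        · exact (by obtain ⟨k, rfl⟩ := hn; exact ⟨1, -k, by ring⟩)
        · exact ((Nat.prime_iff_prime_int.1 hl).irreducible.coprime_iff_not_dvd.2 hln).symm
  · exact fun n _ _ _ => hrefl n
  · refine fun d _ _ hd => ⟨?_, hrefl _⟩
    obtain ⟨k, hk⟩ := hd
    exact ⟨(l : ℤ) ^ 2 - k * l - 1, by rw [hk]; ring⟩
  · intro n
    have h := H.isUnit_jac_one n
    rw [← hT] at h
    obtain ⟨b, hb⟩ := h.exists_right_inv
    obtain ⟨u, rfl⟩ := hsurj b
    refine ⟨u, u.2, ?_⟩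
    rw [hJ, ← Subalgebra.coe_mul, ← (JacobiCong.ringZ l).coe_one]
    apply hcong
    rw [map_mul, map_one]
    exact hb
  · intro i j hj
    obtain ⟨k, rfl⟩ := Nat.exists_eq_add_of_le' hj
    have h1 := hcong (a := (∑ v, (X ^ (i : ℤ)) v * (X ^ ((k + 1 : ℕ) : ℤ)) (v + 1)) *
        ∏ t ∈ Finset.Ico 1 (k + 1), ∑ v, (X ^ (1 : ℤ)) v * (X ^ (t : ℤ)) (v + 1))
      (b := (X ^ (1 : ℤ)) (-1) ^ (i + 1) *
        ∏ t ∈ Finset.Ico i (i + (k + 1)), ∑ v, (X ^ (1 : ℤ)) v * (X ^ (t : ℤ)) (v + 1)) (by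
        rw [map_mul, map_mul, map_prod, map_prod, map_pow]
        simp only [hT]
        rw [H.jac_mul_prod, MulChar.ringHomComp_zpow, MulChar.ringHomComp_apply])
    simp only [hJ, hchi]
    have hprod : ∀ (s : Finset ℕ) (f : ℕ → JacobiCong.ringZ l),
        ((∏ t ∈ s, f t : JacobiCong.ringZ l) : ℂ) = ∏ t ∈ s, (f t : ℂ) := fun s f =>
      map_prod (JacobiCong.ringZ l).val f s
    simpa only [Subalgebra.coe_mul, hprod, Subalgebra.coe_pow] using h1
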